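/- Let $f:\mathbb{R}^n\to\mathbb{R}$ and $g:\mathbb{R}^n\to\mathbb{R}^m$ be twice continuously differentiable, $K\subseteq\mathbb{R}^m$ closed, $C:=g^{-1}(K)$, and $L(x,\lambda):=f(x)+\langle\lambda,g(x)\rangle$. Notation. Let $S$ be a subset of a Euclidean space. Throughout, $t_k\downarrow0$ (or $t\downarrow 0$) means convergence to $0$ through positive values. $T_S(x)$ is the set of $d$ for which there are $t_k\downarrow0$, $d_k\to d$ with $x+t_kd_k\in S$. $T^2_S(x;d)$ is the set of $w$ for which there are $t_k\downarrow0$, $w_k\to w$ with $x+t_kd+\tfrac12t_k^2w_k\in S$. $T''_S(x;d)$ is the set of $w$ for which there are $t_k\downarrow0$, $r_k\downarrow0$ with $t_k/r_k\to0$ and $w_k\to w$ with $x+t_kd+\tfrac12t_kr_kw_k\in S$. For $x\in S$, $\hat N_S(x):=\{v:\limsup_{y\to x,\,y\in S,\,y\neq x}\langle v,y-x\rangle/\|y-x\|\le0\}$ (a $\limsup$ over no points is $-\infty$), and $\hat N_S(x):=\emptyset$ for $x\notin S$. $N_S(x)$ is the set of limits of sequences $v_k\in\hat N_S(x_k)$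 with $x_k\to x$ if $x\in S$, and $N_S(x):=\emptyset$ if $x\notin S$. $N_S(x;d)$ is the set of limits of sequences $v_k\in\hat N_S(x+t_kd_k)$ with $t_k\downarrow0$, $d_k\to d$. For $S\ne\emptyset$ and any set $A$, the lower generalized support function is $$\hat\sigma_{S,A}(\lambda):=\liminf_{\lambda'\to\lambda}\ \inf\{\langle\lambda',u\rangle : u\in A,\ \lambda'\in N_S(u)\}\in\mathbb{R}\cup\{\pm\infty\}$$ (with $\inf\emptyset=+\infty$, and $\lambda'=\lambda$ allowed in the lower limit); $\hat\sigma_{\emptyset,A}:=-\infty$; and $\hat\sigma_S:=\hat\sigma_{S,A}$ with $A$ the whole space. For $\rho,\delta>0$ let $V_{\rho,\delta}(d):=\{w:\|w\|\le\delta,\ \big\|\|d\|w-\|w\|d\big\|\le\rho\|w\|\|d\|\}$. Assumptions. Let $\bar x\in C$ and $d\in T_C(\bar x)$ with $\nabla f(\bar x)d=0$. Suppose that $\bar x$ is a local minimizer in direction $d$, i.e. for some $\rho,\delta>0$, $f(x)\ge f(\bar x)$ for all $x\in C\cap(\bar x+V_{\rho,\delta}(d))$. Suppose also that the metric subregularity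 constraint qualification holds at $\bar x$ in direction $d$, i.e. there are $\rho,\delta,\kappa>0$ with $\operatorname{dist}(x,C)\le\kappa\operatorname{dist}(g(x),K)$ for all $x\in\bar x+V_{\rho,\delta}(d)$. Put $$\Lambda(\bar x;d):=\{\lambda\in\mathbb{R}^m:\lambda\in N_K(g(\bar x);\nabla g(\bar x)d),\ \nabla_xL(\bar x,\lambda)=0\},$$ $$\Theta:=\nabla g(\bar x)(T''_C(\bar x;d)),\qquad \Omega:=\nabla g(\bar x)(T^2_C(\bar x;d))+\nabla^2g(\bar x)(d,d).$$ Theorem. (i) There is $\lambda\in\Lambda(\bar x;d)$ such that $\hat\sigma_{T''_K(g(\bar x);\nabla g(\bar x)d),A}(\lambda)\le0$ for every set $A\subseteq\mathbb{R}^m$ with $A\supseteq\Theta$; in particular $\hat\sigma_{T''_K(g(\bar x);\nabla g(\bar x)d)}(\lambda)\le0$. (ii) If $T^2_K(g(\bar x);\nabla g(\bar x)d)\neq\emptyset$, there is $\lambda\in\Lambda(\bar x;d)$ such that $$\nabla^2_{xx}L(\bar x,\lambda)(d,d)-\hat\sigma_{T^2_K(g(\bar x);\nabla g(\bar x)d),B}(\lambda)\ge0$$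 for every set $B\subseteq\mathbb{R}^m$ with $B\supseteq\Omega$; in particular $\nabla^2_{xx}L(\bar x,\lambda)(d,d)-\hat\sigma_{T^2_K(g(\bar x);\nabla g(\bar x)d)}(\lambda)\ge0$. -/

import Mathlib

open Filter Topology

namespace DirOpt

section Cones

variable {E : Type*} [NormedAddCommGroup E] [InnerProductSpace ℝ E]

/-- The contingent (Bouligand) tangent cone `T_S(x)`. -/
def tangentCone (S : Set E) (x : E) : Set E :=
  {d | ∃ (t : ℕ → ℝ) (e : ℕ → E), (∀ k, 0 < t k) ∧ Tendsto t atTop (𝓝 0) ∧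
    Tendsto e atTop (𝓝 d) ∧ ∀ k, x + t k • e k ∈ S}

/-- The (outer) second-order tangent set `T_S²(x; d)`. -/
def secondTangentSet (S : Set E) (x d : E) : Set E :=
  {w | ∃ (t : ℕ → ℝ) (u : ℕ → E), (∀ k, 0 < t k) ∧ Tendsto t atTop (𝓝 0) ∧
    Tendsto u atTop (𝓝 w) ∧ ∀ k, x + t k • d + ((1 / 2 : ℝ) * t k ^ 2) • u k ∈ S}

/-- The asymptotic second-order tangent cone `T_S''(x; d)`. -/
def asympTangentCone (S : Set E) (x d : E) : Set E :=
  {w | ∃ (t r : ℕ → ℝ) (u : ℕ → E), (∀ k, 0 < t k) ∧ Tendsto t atTop (𝓝 0) ∧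
    (∀ k, 0 < r k) ∧ Tendsto r atTop (𝓝 0) ∧ Tendsto (fun k => t k / r k) atTop (𝓝 0) ∧
    Tendsto u atTop (𝓝 w) ∧ ∀ k, x + t k • d + ((1 / 2 : ℝ) * t k * r k) • u k ∈ S}

/-- The Fréchet (regular) normal cone: the vectors `v` with
`limsup ⟪v, y - x⟫ / ‖y - x‖ ≤ 0` as `y → x` in `S`; it is empty when `x ∉ S`. -/
def frechetNormalCone (S : Set E) (x : E) : Set E :=
  {v | x ∈ S ∧ ∀ ε : ℝ, 0 < ε → ∀ᶠ y in 𝓝[S] x, inner ℝ v (y - x) ≤ ε * ‖y - x‖}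

/-- The limiting (Mordukhovich) normal cone `N_S(x)`, empty when `x ∉ S`. -/
def limitingNormalCone (S : Set E) (x : E) : Set E :=
  {v | x ∈ S ∧ ∃ (y u : ℕ → E), Tendsto y atTop (𝓝 x) ∧ Tendsto u atTop (𝓝 v) ∧
    ∀ k, u k ∈ frechetNormalCone S (y k)}

/-- The limiting normal cone `N_S(x; d)` in direction `d`. -/
def dirNormalCone (S : Set E) (x d : E) : Set E :=
  {v | ∃ (t : ℕ → ℝ) (e u : ℕ → E), (∀ k, 0 < t k) ∧ Tendsto t atTop (𝓝 0) ∧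
    Tendsto e atTop (𝓝 d) ∧ Tendsto u atTop (𝓝 v) ∧
    ∀ k, u k ∈ frechetNormalCone S (x + t k • e k)}

open Classical in
/-- The lower generalized support function of `S` with respect to `A`: the lower limit, as
`l' → l` (the value `l' = l` is allowed), of the infimum of `⟪l', u⟫` over the `u ∈ A` with
`l' ∈ N_S(u)`; it is `-∞` when `S` is empty. -/
noncomputable def lowerGenSupport (S A : Set E) (l : E) : EReal :=
  if S = ∅ then ⊥
  else liminf (fun l' : E =>
    ⨅ u ∈ {u : E | l' ∈ limitingNormalCone S u} ∩ A, ((inner ℝ l' u : ℝ) : EReal)) (𝓝 l)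

/-- The directional neighborhood `V_{ρ,δ}(d)` of the origin. -/
def dirNhd (ρ δ : ℝ) (d : E) : Set E :=
  {w | ‖w‖ ≤ δ ∧ ‖‖d‖ • w - ‖w‖ • d‖ ≤ ρ * ‖w‖ * ‖d‖}

/-- `x` is a local minimizer of `f` over `C` in direction `d`. -/
def IsDirLocalMin (f : E → ℝ) (C : Set E) (x d : E) : Prop :=
  x ∈ C ∧ ∃ ρ δ : ℝ, 0 < ρ ∧ 0 < δ ∧ ∀ y ∈ C, y - x ∈ dirNhd ρ δ d → f x ≤ f y

end Cones

section Problem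

variable {E F : Type*} [NormedAddCommGroup E] [InnerProductSpace ℝ E]
  [NormedAddCommGroup F] [InnerProductSpace ℝ F]

/-- The set-valued map `M` is metrically subregular at `(x, y)` in direction `d`
(distances to the empty set are `+∞`). -/
def MetricSubregularInDir (M : E → Set F) (x : E) (y : F) (d : E) : Prop :=
  ∃ ρ δ κ : ℝ, 0 < ρ ∧ 0 < δ ∧ 0 < κ ∧ ∀ z : E, z - x ∈ dirNhd ρ δ d →
    Metric.infEDist z {z' | y ∈ M z'} ≤ ENNReal.ofReal κ * Metric.infEDist y (M z)

/-- The metric subregularity constraint qualification at `x` in direction `d` for the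
system `g(x) ∈ K`: directional metric subregularity of `z ↦ g(z) - K` at `(x, 0)`. -/
def DirMSCQ (g : E → F) (K : Set F) (x d : E) : Prop :=
  MetricSubregularInDir (fun z => (fun y => g z - y) '' K) x 0 d

/-- The second derivative `∇²h(x)(u, v)`. -/
noncomputable def secondDeriv {G : Type*} [NormedAddCommGroup G] [NormedSpace ℝ G]
    (h : E → G) (x u v : E) : G :=
  fderiv ℝ (fderiv ℝ h) x u v

/-- The Lagrangian `L(x, l) = f(x) + ⟪l, g(x)⟫`. -/
def lagrangian (f : E → ℝ) (g : E → F) (x : E) (l : F) : ℝ :=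
  f x + inner ℝ l (g x)

/-- The set `Λ(x; d)` of M-multipliers in direction `d`. -/
def dirMultipliers (f : E → ℝ) (g : E → F) (K : Set F) (x d : E) : Set F :=
  {l | l ∈ dirNormalCone K (g x) (fderiv ℝ g x d) ∧
    fderiv ℝ (fun z => lagrangian f g z l) x = 0}

/-- `Θ = ∇g(x)(T_C''(x; d))` with `C = g⁻¹(K)`. -/
def Theta (g : E → F) (K : Set F) (x d : E) : Set F :=
  fderiv ℝ g x '' asympTangentCone (g ⁻¹' K) x d

/-- `Ω = ∇g(x)(T_C²(x; d)) + ∇²g(x)(d, d)` with `C = g⁻¹(K)`. -/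
def Omega (g : E → F) (K : Set F) (x d : E) : Set F :=
  (fun w => fderiv ℝ g x w + secondDeriv g x d d) '' secondTangentSet (g ⁻¹' K) x d

end Problem

end DirOpt

/-!
# Second-order optimality conditions in a direction

All the tangent sets involved are outer limits (`outerLimit`) of rescalings `(S - c i) / τ i` of a
set `S`, along a filter of scales; the limiting normals in a direction form an outer limit as well.
Write `𝒞` and `S` for the tangent sets of one kind (first-order, second-order or asymptotic) of the
feasible set `g ⁻¹' K` at `x` and of `K` at `g x`. Then the following hold.

* The constraint qualification and a Taylor expansion of `g` give the error bound
  `dist(w, 𝒞) ≤ κ dist(A w + b, S)`, where `A = ∇g(x)` and `b` is `∇²g(x)(d, d)` for the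
  second-order tangent set and `0` otherwise; for the first-order cone it is used only for `w`
  near `d` (`exists_mem_outerLimit_norm_sub_le`, `tendsto_second_order_quotient`). A Taylor expansion of `f` shows that the linear functional
  `∇f(x)` is bounded below on `𝒞`, again near `d` for the first-order cone
  (`nonneg_of_mem_outerLimit`).
* Under such an error bound, a quadratic penalty gives at each point `w₀` where `-P` is a proximal
  normal to `𝒞` a multiplier `l ∈ N_S(A w₀ + b)` with `P + Aᵀ l = 0` and `‖l‖ ≤ 4 κ ‖P‖`
  (`exists_multiplier`).
* Normals to an outer limit are limits of normals to the rescaled sets, hence such an `l` lies in the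
  directional normal cone of `K` (`mem_dirNormalCone_of_mem_limitingNormalCone`).

For the asymptotic cone, `w₀ = 0` minimizes `P = ∇f(x)` over `𝒞`, and the pairing of `l` with
`A w₀ = 0` vanishes. If that cone is empty for `K`, the support function is `-∞`, and a multiplier
from the first-order tangent cone at `d` suffices. For the second-order tangent set a minimizer need not
exist; `∇f(x) w + η ‖w‖²` has a minimizer `w_η`, its multipliers `l_η` stay bounded as `η ↓ 0`, and
`⟪l_η, A w_η + b⟫ = -∇f(x) w_η - 2 η ‖w_η‖² + ⟪l_η, b⟫ ≤ ∇²f(x)(d, d) + ⟪l_η, b⟫`, whose limit is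
the Hessian of the Lagrangian. The points `A w_η + b` lie in the set `Ω`, which is why the
restricted support functions are controlled too.
-/

open Filter Topology

namespace DirOpt

/-! ### Outer limits of set families -/

section OuterLimit

variable {ι α : Type*} [TopologicalSpace α]

/-- The Painlevé–Kuratowski outer limit of the sets `X i` along the filter `ℱ`: the points all of
whose neighbourhoods meet `X i` for frequently many `i`. -/
def outerLimit (ℱ : Filter ι) (X : ι → Set α) : Set α :=
  {u | ∃ᶠ p in ℱ ×ˢ 𝓝 u, p.2 ∈ X p.1}

theorem isClosed_outerLimit (ℱ : Filter ι) (X : ι → Set α) : IsClosed (outerLimit ℱ X) := by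
  rw [← isOpen_compl_iff, isOpen_iff_mem_nhds]
  intro u hu
  simp only [outerLimit, Set.mem_compl_iff, Set.mem_ofPred_eq, not_frequently] at hu
  obtain ⟨pa, ha, pb, hb, h⟩ := eventually_prod_iff.1 hu
  filter_upwards [eventually_eventually_nhds.2 hb] with v hv
  simp only [outerLimit, Set.mem_compl_iff, Set.mem_ofPred_eq, not_frequently]
  exact eventually_prod_iff.2 ⟨pa, ha, pb, hv, h⟩

theorem exists_mem_outerLimit_of_isCompact {ℱ : Filter ι} {X : ι → Set α} {Q : Set α}
    (hQ : IsCompact Q) (h : ∃ᶠ i in ℱ, (X i ∩ Q).Nonempty) : (outerLimit ℱ X ∩ Q).Nonempty := by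
  by_contra hne
  have h1 : ∀ u ∈ Q, {p : ι × α | p.2 ∉ X p.1} ∈ ℱ ×ˢ 𝓝 u := by
    intro u hu
    by_contra hn
    exact hne ⟨u, hn, hu⟩
  have h2 := hQ.mem_prod_nhdsSet_of_forall h1
  obtain ⟨pa, ha, pb, hb, h3⟩ := eventually_prod_iff.1 h2
  obtain ⟨i, ⟨u, huX, huQ⟩, hi⟩ := (h.and_eventually ha).exists
  exact h3 hi (subset_of_mem_nhdsSet hb huQ) huX

theorem mem_outerLimit_iff_exists_seq [FirstCountableTopology α] {ℱ : Filter ι}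
    [ℱ.IsCountablyGenerated] {X : ι → Set α} {u : α} :
    u ∈ outerLimit ℱ X ↔ ∃ (i : ℕ → ι) (v : ℕ → α), Tendsto i atTop ℱ ∧
      Tendsto v atTop (𝓝 u) ∧ ∀ k, v k ∈ X (i k) := by
  constructor
  · intro h
    obtain ⟨s, hs, hp⟩ := exists_seq_forall_of_frequently h
    exact ⟨fun k => (s k).1, fun k => (s k).2, tendsto_fst.comp hs, tendsto_snd.comp hs, hp⟩
  · rintro ⟨i, v, hi, hv, h⟩
    exact (hi.prodMk hv).frequently (Frequently.of_forall h)

end OuterLimit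

/-! ### Tangent sets and directional normals as outer limits -/

section Cones

variable {E : Type*} [NormedAddCommGroup E] [InnerProductSpace ℝ E]

theorem tendsto_nhdsGT_zero_iff {t : ℕ → ℝ} :
    (Tendsto t atTop (𝓝 0) ∧ ∀ᶠ k in atTop, 0 < t k) ↔ Tendsto t atTop (𝓝[>] 0) :=
  tendsto_nhdsWithin_iff.symm

theorem exists_subseq_pos {t : ℕ → ℝ} (ht : Tendsto t atTop (𝓝[>] 0)) :
    ∃ N, ∀ k, 0 < t (k + N) := by
  obtain ⟨N, hN⟩ := eventually_atTop.1 (tendsto_nhdsGT_zero_iff.2 ht).2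
  exact ⟨N, fun k => hN _ (Nat.le_add_left _ _)⟩

theorem tangentCone_eq_outerLimit (S : Set E) (x : E) :
    tangentCone S x = outerLimit (𝓝[>] (0 : ℝ)) (fun t => {u | x + t • u ∈ S}) := by
  ext u
  rw [mem_outerLimit_iff_exists_seq]
  constructor
  · rintro ⟨t, e, h0, ht, he, h⟩
    exact ⟨t, e, tendsto_nhdsGT_zero_iff.1 ⟨ht, .of_forall h0⟩, he, h⟩
  · rintro ⟨t, e, ht, he, h⟩
    obtain ⟨N, hN⟩ := exists_subseq_pos ht
    exact ⟨fun k => t (k + N), fun k => e (k + N), hN,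
      (tendsto_add_atTop_iff_nat N).2 (tendsto_nhdsGT_zero_iff.2 ht).1,
      (tendsto_add_atTop_iff_nat N).2 he, fun k => h _⟩

theorem secondTangentSet_eq_outerLimit (S : Set E) (x d : E) :
    secondTangentSet S x d =
      outerLimit (𝓝[>] (0 : ℝ)) (fun t => {u | x + t • d + ((1 / 2 : ℝ) * t ^ 2) • u ∈ S}) := by
  ext u
  rw [mem_outerLimit_iff_exists_seq]
  constructor
  · rintro ⟨t, e, h0, ht, he, h⟩
    exact ⟨t, e, tendsto_nhdsGT_zero_iff.1 ⟨ht, .of_forall h0⟩, he, h⟩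
  · rintro ⟨t, e, ht, he, h⟩
    obtain ⟨N, hN⟩ := exists_subseq_pos ht
    exact ⟨fun k => t (k + N), fun k => e (k + N), hN,
      (tendsto_add_atTop_iff_nat N).2 (tendsto_nhdsGT_zero_iff.2 ht).1,
      (tendsto_add_atTop_iff_nat N).2 he, fun k => h _⟩

/-- The filter of pairs `(t, r)` with `t ↓ 0`, `r ↓ 0` and `t / r → 0`. -/
noncomputable def asympFilter : Filter (ℝ × ℝ) :=
  (𝓝[>] 0 ×ˢ 𝓝[>] 0) ⊓ comap (fun p : ℝ × ℝ => p.1 / p.2) (𝓝 0)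

instance : asympFilter.IsCountablyGenerated := by
  unfold asympFilter; infer_instance

theorem asympTangentCone_eq_outerLimit (S : Set E) (x d : E) :
    asympTangentCone S x d = outerLimit asympFilter
      (fun p => {u | x + p.1 • d + ((1 / 2 : ℝ) * p.1 * p.2) • u ∈ S}) := by
  ext u
  rw [mem_outerLimit_iff_exists_seq]
  constructor
  · rintro ⟨t, r, e, h0, ht, hr0, hr, htr, he, h⟩
    refine ⟨fun k => (t k, r k), e, ?_, he, h⟩
    refine tendsto_inf.2 ⟨?_, tendsto_comap_iff.2 htr⟩
    exact (tendsto_nhdsGT_zero_iff.1 ⟨ht, .of_forall h0⟩).prodMk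
      (tendsto_nhdsGT_zero_iff.1 ⟨hr, .of_forall hr0⟩)
  · rintro ⟨s, e, hs, he, h⟩
    obtain ⟨h1, h2⟩ := tendsto_inf.1 hs
    have ht := tendsto_fst.comp h1
    have hr := tendsto_snd.comp h1
    obtain ⟨N, hN⟩ := exists_subseq_pos ht
    obtain ⟨M, hM⟩ := exists_subseq_pos hr
    refine ⟨fun k => (s (k + (N + M))).1, fun k => (s (k + (N + M))).2, fun k => e (k + (N + M)),
      ?_, ?_, ?_, ?_, ?_, ?_, fun k => h _⟩
    · intro k
      have := hN (k + M)
      rwa [add_assoc, add_comm M N] at this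
    · exact (tendsto_add_atTop_iff_nat (N + M)).2 (tendsto_nhdsGT_zero_iff.2 ht).1
    · intro k
      have := hM (k + N)
      rwa [add_assoc] at this
    · exact (tendsto_add_atTop_iff_nat (N + M)).2 (tendsto_nhdsGT_zero_iff.2 hr).1
    · exact (tendsto_add_atTop_iff_nat (N + M)).2 (tendsto_comap_iff.1 h2)
    · exact (tendsto_add_atTop_iff_nat (N + M)).2 he

theorem dirNormalCone_eq_outerLimit (S : Set E) (x d : E) :
    dirNormalCone S x d = outerLimit (𝓝[>] (0 : ℝ) ×ˢ 𝓝 d)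
      (fun p => frechetNormalCone S (x + p.1 • p.2)) := by
  ext u
  rw [mem_outerLimit_iff_exists_seq]
  constructor
  · rintro ⟨t, e, v, h0, ht, he, hv, h⟩
    exact ⟨fun k => (t k, e k), v,
      (tendsto_nhdsGT_zero_iff.1 ⟨ht, .of_forall h0⟩).prodMk he, hv, h⟩
  · rintro ⟨s, v, hs, hv, h⟩
    have ht := tendsto_fst.comp hs
    obtain ⟨N, hN⟩ := exists_subseq_pos ht
    exact ⟨fun k => (s (k + N)).1, fun k => (s (k + N)).2, fun k => v (k + N), hN,
      (tendsto_add_atTop_iff_nat N).2 (tendsto_nhdsGT_zero_iff.2 ht).1,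
      (tendsto_add_atTop_iff_nat N).2 (tendsto_snd.comp hs),
      (tendsto_add_atTop_iff_nat N).2 hv, fun k => h _⟩

/-! ### Normals to outer limits -/

/-- A proximal normal inequality, required only near the base point, gives a Fréchet normal. -/
theorem mem_frechetNormalCone_of_proximal {S : Set E} {x v : E} (hx : x ∈ S) {c : ℝ}
    (h : ∀ᶠ y in 𝓝[S] x, inner ℝ v (y - x) ≤ c * ‖y - x‖ ^ 2) : v ∈ frechetNormalCone S x := by
  refine ⟨hx, fun ε hε => ?_⟩
  have h1 : Tendsto (fun y => |c| * ‖y - x‖) (𝓝[S] x) (𝓝 0) := by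
    have : Continuous fun y : E => |c| * ‖y - x‖ := by fun_prop
    simpa using (this.tendsto x).mono_left nhdsWithin_le_nhds
  filter_upwards [h, h1.eventually (ge_mem_nhds hε)] with y hy hy1
  have h2 := mul_le_mul_of_nonneg_right hy1 (norm_nonneg (y - x))
  have h3 := mul_le_mul_of_nonneg_right (le_abs_self c) (sq_nonneg ‖y - x‖)
  nlinarith

theorem frechetNormalCone_preimage_affine (S : Set E) (c : E) {τ : ℝ} (hτ : 0 < τ) (u : E) :
    frechetNormalCone {u | c + τ • u ∈ S} u = frechetNormalCone S (c + τ • u) := by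
  ext v
  refine and_congr Iff.rfl (forall₂_congr fun ε hε => ?_)
  have hinv : ∀ y : E, c + τ • (τ⁻¹ • (y - c)) = y := fun y => by
    rw [smul_inv_smul₀ hτ.ne']; abel
  constructor
  · intro h
    have h1 : Tendsto (fun y => τ⁻¹ • (y - c)) (𝓝[S] (c + τ • u)) (𝓝[{u | c + τ • u ∈ S}] u) := by
      refine tendsto_nhdsWithin_iff.2 ⟨?_, ?_⟩
      · have : Continuous fun y : E => τ⁻¹ • (y - c) := by fun_prop
        have h2 := (this.tendsto (c + τ • u)).mono_left (nhdsWithin_le_nhds (s := S))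
        simpa [inv_smul_smul₀ hτ.ne'] using h2
      · filter_upwards [self_mem_nhdsWithin] with y hy
        simpa only [Set.mem_ofPred_eq, hinv] using hy
    filter_upwards [h1.eventually h] with y hy
    have h3 : y - (c + τ • u) = τ • (τ⁻¹ • (y - c) - u) := by
      rw [smul_sub, smul_inv_smul₀ hτ.ne']; abel
    rw [h3, inner_smul_right, norm_smul, Real.norm_of_nonneg hτ.le]
    nlinarith
  · intro h
    have h1 : Tendsto (fun w => c + τ • w) (𝓝[{u | c + τ • u ∈ S}] u) (𝓝[S] (c + τ • u)) := by
      refine tendsto_nhdsWithin_iff.2 ⟨?_, ?_⟩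
      · have : Continuous fun y : E => c + τ • y := by fun_prop
        exact (this.tendsto u).mono_left nhdsWithin_le_nhds
      · filter_upwards [self_mem_nhdsWithin] with y hy using hy
    filter_upwards [h1.eventually h] with y hy
    have h3 : c + τ • y - (c + τ • u) = τ • (y - u) := by
      rw [smul_sub]; abel
    rw [h3, inner_smul_right, norm_smul, Real.norm_of_nonneg hτ.le] at hy
    refine le_of_mul_le_mul_left ?_ hτ
    linarith

variable {ι : Type*} [ProperSpace E]

/-- A Fréchet normal to an outer limit of closed sets is approximated by Fréchet normals to the
sets themselves at nearby points. -/
theorem mem_outerLimit_graph_of_mem_frechetNormalCone {ℱ : Filter ι} {X : ι → Set E}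
    (hX : ∀ i, IsClosed (X i)) {u v : E} (hv : v ∈ frechetNormalCone (outerLimit ℱ X) u) :
    (u, v) ∈ outerLimit ℱ (fun i => {p : E × E | p.2 ∈ frechetNormalCone (X i) p.1}) := by
  obtain ⟨hu, hv⟩ := hv
  suffices key : ∀ ε > 0, ∃ᶠ i in ℱ, ∃ u' v', ‖u' - u‖ < ε ∧ ‖v' - v‖ < ε ∧
      v' ∈ frechetNormalCone (X i) u' by
    intro hn
    obtain ⟨pa, ha, pb, hb, h⟩ := eventually_prod_iff.1 hn
    obtain ⟨ε, hε, hball⟩ := Metric.eventually_nhds_iff.1 hb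
    obtain ⟨i, ⟨u', v', hu', hv', hm⟩, hi⟩ := ((key ε hε).and_eventually ha).exists
    refine h hi (hball (y := (u', v')) ?_) hm
    simpa [Prod.dist_eq, dist_eq_norm] using And.intro hu' hv'
  intro ε hε
  obtain ⟨δ₀, hδ₀, hδ⟩ := Metric.eventually_nhds_iff.1
    (eventually_nhdsWithin_iff.1 (hv (ε / 8) (by positivity)))
  -- On the sphere of radius `δ` the function `ψ` below is at least `ε / 8 * δ` at the points of the
  -- outer limit, so that its minimizers over `X i` in the ball are interior.
  obtain ⟨δ, hδ0, hδε, hδδ⟩ : ∃ δ, 0 < δ ∧ δ < ε ∧ δ < δ₀ :=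
    ⟨min ε δ₀ / 2, by positivity, by linarith [min_le_left ε δ₀], by
      linarith [min_le_right ε δ₀, lt_min hε hδ₀]⟩
  set a : ℝ := ε / 4 / δ with ha
  have ha0 : 0 < a := by positivity
  have haδ : a * δ = ε / 4 := by rw [ha]; field_simp
  set ψ : E → ℝ := fun y => -inner ℝ v (y - u) + a * ‖y - u‖ ^ 2 with hψ
  have hψc : Continuous ψ := by fun_prop
  have hψu : ψ u = 0 := by simp [hψ]
  set c : ℝ := ε / 16 * δ with hc
  have hc0 : 0 < c := by positivity
  have hsphere : ∀ᶠ i in ℱ, ∀ y ∈ Metric.sphere u δ, y ∈ X i → c < ψ y := by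
    have hcpt : IsCompact (Metric.sphere u δ ∩ {y | ψ y ≤ c}) :=
      (isCompact_sphere u δ).inter_right (isClosed_le hψc continuous_const)
    by_contra hn
    have hn' : ∃ᶠ i in ℱ, (X i ∩ (Metric.sphere u δ ∩ {y | ψ y ≤ c})).Nonempty := by
      refine (not_eventually.1 hn).mono fun i hi => ?_
      push Not at hi
      obtain ⟨y, h1, h2, h3⟩ := hi
      exact ⟨y, h2, h1, h3⟩
    obtain ⟨y, hyT, hyS, hyc⟩ := exists_mem_outerLimit_of_isCompact hcpt hn'
    have hyn : ‖y - u‖ = δ := by rwa [← dist_eq_norm]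
    have h1 := hδ (y := y) (by rw [dist_eq_norm, hyn]; exact hδδ) hyT
    have h2 : -inner ℝ v (y - u) + a * ‖y - u‖ ^ 2 ≤ c := hyc
    rw [hyn] at h1 h2
    have h3 : a * δ ^ 2 = ε / 4 * δ := by rw [← haδ]; ring
    have : 0 < ε * δ := by positivity
    nlinarith
  have hnear : ∃ᶠ i in ℱ, ∃ y ∈ X i, ‖y - u‖ < δ ∧ ψ y < c := by
    have h1 : ∀ᶠ p in ℱ ×ˢ 𝓝 u, ‖p.2 - u‖ < δ ∧ ψ p.2 < c := by
      have h2 : ∀ᶠ y in 𝓝 u, ‖y - u‖ < δ ∧ ψ y < c := by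
        refine Filter.Eventually.and ?_ ?_
        · filter_upwards [Metric.ball_mem_nhds u hδ0] with y hy
          rwa [← dist_eq_norm]
        · exact hψc.continuousAt.eventually_lt continuousAt_const (by rw [hψu]; exact hc0)
      exact tendsto_snd.eventually h2
    refine tendsto_fst.frequently ((Filter.Frequently.and_eventually hu h1).mono ?_)
    rintro ⟨i, y⟩ ⟨h2, h3⟩
    exact ⟨y, h2, h3⟩
  refine (hnear.and_eventually hsphere).mono ?_
  rintro i ⟨⟨y, hyX, hyδ, hyc⟩, hi⟩
  have hcpt : IsCompact (X i ∩ Metric.closedBall u δ) :=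
    (isCompact_closedBall u δ).inter_left (hX i)
  have hymem : y ∈ X i ∩ Metric.closedBall u δ :=
    ⟨hyX, by rw [Metric.mem_closedBall, dist_eq_norm]; exact hyδ.le⟩
  obtain ⟨z, ⟨hzX, hzb⟩, hz⟩ := hcpt.exists_isMinOn ⟨y, hymem⟩ hψc.continuousOn
  have hzc : ψ z < c := (hz hymem).trans_lt hyc
  have hzδ : ‖z - u‖ < δ := by
    rw [Metric.mem_closedBall, dist_eq_norm] at hzb
    refine lt_of_le_of_ne hzb fun h => ?_
    exact absurd (hi z (by rw [mem_sphere_iff_norm]; exact h) hzX) (not_lt.2 hzc.le)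
  refine ⟨z, v - (2 * a) • (z - u), hzδ.trans hδε, ?_, ?_⟩
  · have : v - (2 * a) • (z - u) - v = -((2 * a) • (z - u)) := by abel
    rw [this, norm_neg, norm_smul, Real.norm_of_nonneg (by positivity)]
    nlinarith
  · refine mem_frechetNormalCone_of_proximal hzX (c := a) ?_
    have hb : Metric.ball u δ ∈ 𝓝 z := Metric.isOpen_ball.mem_nhds (by
      rw [Metric.mem_ball, dist_eq_norm]; exact hzδ)
    filter_upwards [self_mem_nhdsWithin, mem_nhdsWithin_of_mem_nhds hb] with w hwX hwb
    have h1 : ψ z ≤ ψ w := hz ⟨hwX, Metric.ball_subset_closedBall hwb⟩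
    simp only [hψ] at h1
    have h2 : w - u = (w - z) + (z - u) := by abel
    rw [h2, inner_add_right, norm_add_sq_real] at h1
    rw [inner_sub_left, inner_smul_left, real_inner_comm]
    simp only [conj_trivial]
    rw [real_inner_comm (w - z) v, real_inner_comm (w - z) (z - u)] at *
    nlinarith

theorem mem_outerLimit_graph_of_mem_limitingNormalCone {ℱ : Filter ι} {X : ι → Set E}
    (hX : ∀ i, IsClosed (X i)) {u v : E} (hv : v ∈ limitingNormalCone (outerLimit ℱ X) u) :
    (u, v) ∈ outerLimit ℱ (fun i => {p : E × E | p.2 ∈ frechetNormalCone (X i) p.1}) := by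
  obtain ⟨-, y, w, hy, hw, h⟩ := hv
  exact (isClosed_outerLimit _ _).mem_of_tendsto (hy.prodMk_nhds hw)
    (.of_forall fun k => mem_outerLimit_graph_of_mem_frechetNormalCone hX (h k))

/-- Limiting normals at `u` to the outer limit of the rescaled sets `(S - c i) / τ i` are limiting
normals to `S` in direction `e` when `c i + τ i • u' = x + t i • e'` with `e' → e` as `u' → u`. -/
theorem mem_dirNormalCone_of_mem_limitingNormalCone {ℱ : Filter ι} {S : Set E} (hS : IsClosed S)
    {c : ι → E} {τ t : ι → ℝ} {x e u v : E} (hτ : ∀ᶠ i in ℱ, 0 < τ i)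
    (ht : Tendsto t ℱ (𝓝[>] 0)) {φ : ι × E → E} (hφ : Tendsto φ (ℱ ×ˢ 𝓝 u) (𝓝 e))
    (hc : ∀ᶠ i in ℱ, ∀ y, c i + τ i • y = x + t i • φ (i, y))
    (hv : v ∈ limitingNormalCone (outerLimit ℱ fun i => {y | c i + τ i • y ∈ S}) u) :
    v ∈ dirNormalCone S x e := by
  have h1 := mem_outerLimit_graph_of_mem_limitingNormalCone
    (fun i => hS.preimage (by fun_prop : Continuous fun y => c i + τ i • y)) hv
  rw [dirNormalCone_eq_outerLimit]
  rw [outerLimit, Set.mem_ofPred_eq, nhds_prod_eq] at h1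
  have hcτ : ∀ᶠ p : ι × E × E in ℱ ×ˢ (𝓝 u ×ˢ 𝓝 v), 0 < τ p.1 ∧
      ∀ y, c p.1 + τ p.1 • y = x + t p.1 • φ (p.1, y) := tendsto_fst.eventually (hτ.and hc)
  have hlim : Tendsto (fun p : ι × E × E => ((t p.1, φ (p.1, p.2.1)), p.2.2))
      (ℱ ×ˢ (𝓝 u ×ˢ 𝓝 v)) ((𝓝[>] 0 ×ˢ 𝓝 e) ×ˢ 𝓝 v) :=
    ((ht.comp tendsto_fst).prodMk
      (hφ.comp (tendsto_fst.prodMk (tendsto_fst.comp tendsto_snd)))).prodMk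
      (tendsto_snd.comp tendsto_snd)
  refine hlim.frequently ((h1.and_eventually hcτ).mono ?_)
  rintro ⟨i, y, w⟩ ⟨h2, h3, h4⟩
  simp only [Set.mem_ofPred_eq] at h2 h3 h4 ⊢
  rw [← h4, ← frechetNormalCone_preimage_affine S (c i) h3]
  exact h2

end Cones

/-! ### Second-order expansions -/

section Expansion

variable {E G ι : Type*} [NormedAddCommGroup E] [NormedSpace ℝ E]
  [NormedAddCommGroup G] [NormedSpace ℝ G]

open Asymptotics in
theorem isLittleO_second_order {g : E → G} (hg : ContDiff ℝ 2 g) (x : E) :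
    (fun h => g (x + h) - g x - fderiv ℝ g x h - (1 / 2 : ℝ) • fderiv ℝ (fderiv ℝ g) x h h)
      =o[𝓝 0] fun h => ‖h‖ ^ 2 := by
  have hsymm : IsSymmSndFDerivAt ℝ g x :=
    hg.contDiffAt.isSymmSndFDerivAt (by simp)
  have hdiff : ∀ y, HasFDerivAt g (fderiv ℝ g y) y := fun y =>
    (hg.differentiable (by norm_num) y).hasFDerivAt
  have hd2 : HasFDerivAt (fderiv ℝ g) (fderiv ℝ (fderiv ℝ g) x) x :=
    ((hg.fderiv_right (m := 1) (by norm_num)).differentiable (by norm_num) x).hasFDerivAt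
  set B := fderiv ℝ (fderiv ℝ g) x with hB
  set R : E → G := fun h => g (x + h) - g x - fderiv ℝ g x h - (1 / 2 : ℝ) • B h h with hR
  have hR' : ∀ h, HasFDerivAt R (fderiv ℝ g (x + h) - fderiv ℝ g x - B h) h := by
    intro h
    have h1 : HasFDerivAt (fun h => g (x + h)) (fderiv ℝ g (x + h)) h := by
      exact (hdiff (x + h)).comp h ((hasFDerivAt_id h).const_add x)
    have h2 : HasFDerivAt (fun h => B h h) (B h + B.flip h) h := by
      have := B.hasFDerivAt (x := h) |>.clm_apply (hasFDerivAt_id h)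
      refine this.congr_fderiv ?_
      ext k; simp
    have h3 := ((h1.sub_const (g x)).sub (fderiv ℝ g x).hasFDerivAt).sub
      (h2.const_smul (1 / 2 : ℝ))
    refine h3.congr_fderiv ?_
    have h4 : B.flip h = B h := by
      ext k; exact hsymm k h
    rw [h4]
    ext k
    simp only [sub_apply, smul_apply, add_apply]
    module
  refine isLittleO_iff.2 fun ε hε => ?_
  have h5 := (hasFDerivAt_iff_isLittleO_nhds_zero.1 hd2)
  obtain ⟨δ, hδ, hb⟩ := Metric.eventually_nhds_iff.1 (isLittleO_iff.1 h5 hε)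
  filter_upwards [Metric.ball_mem_nhds (0 : E) hδ] with h hh
  have hh' : ‖h‖ < δ := by simpa using hh
  have h6 := (convex_closedBall (0 : E) ‖h‖).norm_image_sub_le_of_norm_hasFDerivWithin_le
    (f := R) (C := ε * ‖h‖) (x := 0) (y := h)
    (fun k _ => (hR' k).hasFDerivWithinAt) (fun k hk => by
      have hk' : ‖k‖ ≤ ‖h‖ := by simpa using hk
      refine (hb (y := k) (by simpa using hk'.trans_lt hh')).trans ?_
      gcongr) (by simp) (by simp)
  have h7 : R 0 = 0 := by simp [hR]
  rw [h7, sub_zero, sub_zero] at h6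
  rw [Real.norm_of_nonneg (by positivity : 0 ≤ ‖h‖ ^ 2)]
  calc ‖R h‖ ≤ ε * ‖h‖ * ‖h‖ := h6
    _ = ε * ‖h‖ ^ 2 := by ring

theorem tendsto_first_order_quotient {g : E → G} {x : E} (hg : DifferentiableAt ℝ g x) (w : E) :
    Tendsto (fun p : ℝ × E => p.1⁻¹ • (g (x + p.1 • p.2) - g x)) (𝓝[>] 0 ×ˢ 𝓝 w)
      (𝓝 (fderiv ℝ g x w)) := by
  have hpos : ∀ᶠ p : ℝ × E in 𝓝[>] 0 ×ˢ 𝓝 w, 0 < p.1 :=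
    tendsto_fst.eventually self_mem_nhdsWithin
  have h1 : Tendsto (fun p : ℝ × E => p.1) (𝓝[>] 0 ×ˢ 𝓝 w) (𝓝[>] 0) := tendsto_fst
  refine (hasFDerivWithinAt_univ.2 hg.hasFDerivAt).lim (c := fun p : ℝ × E => p.1⁻¹)
    (d := fun p : ℝ × E => p.1 • p.2) ?_ (.of_forall fun _ => Set.mem_univ _) ?_
  · simpa using (tendsto_nhdsWithin_iff.1 h1).1.smul
      (tendsto_snd : Tendsto Prod.snd (𝓝[>] (0 : ℝ) ×ˢ 𝓝 w) (𝓝 w))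
  · refine (tendsto_snd : Tendsto Prod.snd (𝓝[>] (0 : ℝ) ×ˢ 𝓝 w) (𝓝 w)).congr' ?_
    filter_upwards [hpos] with p hp
    rw [inv_smul_smul₀ hp.ne']

open Asymptotics in
/-- Second-order difference quotients along `x + t • d + τ • w'`, for scales `τ = o(t)` such that
`t ^ 2 / (2 τ)` has a limit `c`: the contribution `c • ∇²g(x)(d, d)` of the curvature of `g` is
the whole Hessian term for `τ = t² / 2` and vanishes for `τ = t r / 2` with `t / r → 0`. -/
theorem tendsto_second_order_quotient {g : E → G} (hg : ContDiff ℝ 2 g) (x d w : E)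
    {ℱ : Filter ι} {t τ : ι → ℝ} {c : ℝ} (ht : Tendsto t ℱ (𝓝[>] 0)) (hτ : ∀ᶠ i in ℱ, 0 < τ i)
    (hτt : Tendsto (fun i => τ i / t i) ℱ (𝓝 0))
    (hc : Tendsto (fun i => t i ^ 2 / (2 * τ i)) ℱ (𝓝 c)) :
    Tendsto (fun p : ι × E => (τ p.1)⁻¹ •
        (g (x + t p.1 • d + τ p.1 • p.2) - (g x + t p.1 • fderiv ℝ g x d))) (ℱ ×ˢ 𝓝 w)
      (𝓝 (fderiv ℝ g x w + c • fderiv ℝ (fderiv ℝ g) x d d)) := by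
  set L := ℱ ×ˢ 𝓝 w with hL
  have hfst : Tendsto Prod.fst L ℱ := tendsto_fst
  have hsnd : Tendsto Prod.snd L (𝓝 w) := tendsto_snd
  obtain ⟨ht0, htpos⟩ := tendsto_nhdsWithin_iff.1 ht
  have hpos : ∀ᶠ p in L, 0 < τ p.1 ∧ 0 < t p.1 := hfst.eventually (hτ.and htpos)
  set e : ι × E → E := fun p => d + (τ p.1 / t p.1) • p.2 with he
  have helim : Tendsto e L (𝓝 d) := by
    simpa using tendsto_const_nhds.add ((hτt.comp hfst).smul hsnd)
  have hh0 : Tendsto (fun p => t p.1 • e p) L (𝓝 0) := by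
    simpa using (ht0.comp hfst).smul helim
  have hrem : Tendsto (fun p : ι × E => (τ p.1)⁻¹ • (g (x + t p.1 • e p) - g x
      - fderiv ℝ g x (t p.1 • e p)
      - (1 / 2 : ℝ) • fderiv ℝ (fderiv ℝ g) x (t p.1 • e p) (t p.1 • e p))) L (𝓝 0) := by
    have h1 := (isLittleO_second_order hg x).comp_tendsto hh0
    have h2 : (fun p => ‖t p.1 • e p‖ ^ 2) =O[L] fun p => τ p.1 := by
      refine isBigO_of_div_tendsto_nhds (hpos.mono fun p hp h => absurd h hp.1.ne')
        (2 * c * ‖d‖ ^ 2) ?_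
      refine (((hc.comp hfst).const_mul 2).mul (helim.norm.pow 2)).congr' ?_
      filter_upwards [hpos] with p hp
      have := hp.1.ne'
      simp only [Function.comp, Pi.div_apply, norm_smul, Real.norm_of_nonneg hp.2.le]
      field_simp
    exact (h1.trans_isBigO h2).tendsto_inv_smul_nhds_zero
  have hmain : Tendsto (fun p : ι × E => fderiv ℝ g x p.2 +
      (t p.1 ^ 2 / (2 * τ p.1)) • fderiv ℝ (fderiv ℝ g) x (e p) (e p)) L
      (𝓝 (fderiv ℝ g x w + c • fderiv ℝ (fderiv ℝ g) x d d)) := by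
    have h3 : Continuous fun v : E => fderiv ℝ (fderiv ℝ g) x v v := by fun_prop
    exact (((fderiv ℝ g x).continuous.tendsto w).comp hsnd).add
      ((hc.comp hfst).smul ((h3.tendsto d).comp helim))
  have := hmain.add hrem
  rw [add_zero] at this
  refine this.congr' ?_
  filter_upwards [hpos] with p hp
  have hτ' := hp.1.ne'
  have ht' := hp.2.ne'
  have h4 : t p.1 • e p = t p.1 • d + τ p.1 • p.2 := by
    simp only [he, smul_add, smul_smul]
    congr 2
    field_simp
  have h5 : x + t p.1 • d + τ p.1 • p.2 = x + t p.1 • e p := by rw [h4, add_assoc]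
  rw [h5]
  have h6 : fderiv ℝ g x (t p.1 • e p) =
      t p.1 • fderiv ℝ g x d + τ p.1 • fderiv ℝ g x p.2 := by
    rw [h4, map_add, map_smul, map_smul]
  rw [h6]
  simp only [map_smul, smul_apply]
  match_scalars <;> field_simp <;> ring

end Expansion

/-! ### Transfer of subregularity to outer limits -/

section Transfer

variable {ι E F : Type*} [NormedAddCommGroup E] [InnerProductSpace ℝ E]
  [NormedAddCommGroup F] [InnerProductSpace ℝ F]
  {ℱ : Filter ι} {p : ι → E} {q : ι → F} {τ : ι → ℝ} {g : E → F} {C : Set E} {K : Set F}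

/-- If `dist(z, C) ≤ κ dist(g(z), K)` along the points `p i + τ i • w`, then the outer limits `𝒞` and
`S` of the rescalings of `C` and `K` satisfy `dist(w, 𝒞) ≤ κ dist(b, S)`, where `b` is the limit of
the rescaled values of `g` at these points. -/
theorem exists_mem_outerLimit_norm_sub_le [ProperSpace E] (hτ : ∀ᶠ i in ℱ, 0 < τ i) {κ : ℝ}
    (hκ : 0 < κ) {V : Set E} (hsub : ∀ z ∈ V, ∀ y ∈ K, ∃ z' ∈ C, ‖z - z'‖ ≤ κ * ‖g z - y‖)
    {w : E} {b : F} (hV : ∀ᶠ i in ℱ, p i + τ i • w ∈ V)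
    (hlim : Tendsto (fun i => (τ i)⁻¹ • (g (p i + τ i • w) - q i)) ℱ (𝓝 b))
    {z : F} (hz : z ∈ outerLimit ℱ (fun i => {y | q i + τ i • y ∈ K})) :
    ∃ w' ∈ outerLimit ℱ (fun i => {y | p i + τ i • y ∈ C}), ‖w - w'‖ ≤ κ * ‖b - z‖ := by
  set 𝒞 := outerLimit ℱ (fun i => {y | p i + τ i • y ∈ C}) with h𝒞
  have key : ∀ ε > 0, (𝒞 ∩ Metric.closedBall w (κ * (‖b - z‖ + ε))).Nonempty := by
    intro ε hε
    refine exists_mem_outerLimit_of_isCompact (isCompact_closedBall _ _) ?_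
    have h1 : ∀ᶠ s : ι × F in ℱ ×ˢ 𝓝 z, (0 < τ s.1 ∧ p s.1 + τ s.1 • w ∈ V) ∧
        ‖(τ s.1)⁻¹ • (g (p s.1 + τ s.1 • w) - q s.1) - s.2‖ < ‖b - z‖ + ε := by
      refine (tendsto_fst.eventually (hτ.and hV)).and ?_
      have h2 : Tendsto (fun s : ι × F => ‖(τ s.1)⁻¹ • (g (p s.1 + τ s.1 • w) - q s.1) - s.2‖)
          (ℱ ×ˢ 𝓝 z) (𝓝 ‖b - z‖) := ((hlim.comp tendsto_fst).sub tendsto_snd).norm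
      exact h2.eventually (gt_mem_nhds (by linarith))
    refine tendsto_fst.frequently ((Filter.Frequently.and_eventually hz h1).mono ?_)
    rintro ⟨i, y⟩ ⟨hy, ⟨hτi, hVi⟩, hn⟩
    simp only [Set.mem_ofPred_eq] at hy hn hτi hVi ⊢
    obtain ⟨z', hz'C, hz'⟩ := hsub _ hVi _ hy
    refine ⟨(τ i)⁻¹ • (z' - p i), ?_, ?_⟩
    · simp only [Set.mem_ofPred_eq]
      rw [smul_inv_smul₀ hτi.ne']
      simpa using hz'C
    · rw [Metric.mem_closedBall, dist_comm, dist_eq_norm]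
      have h3 : w - (τ i)⁻¹ • (z' - p i) = (τ i)⁻¹ • (p i + τ i • w - z') := by
        match_scalars <;> field_simp
      have h4 : (τ i)⁻¹ • (g (p i + τ i • w) - q i) - y =
          (τ i)⁻¹ • (g (p i + τ i • w) - (q i + τ i • y)) := by
        match_scalars <;> field_simp
      rw [h4, norm_smul, norm_inv, Real.norm_of_nonneg hτi.le] at hn
      rw [h3, norm_smul, norm_inv, Real.norm_of_nonneg hτi.le]
      calc (τ i)⁻¹ * ‖p i + τ i • w - z'‖
          ≤ (τ i)⁻¹ * (κ * ‖g (p i + τ i • w) - (q i + τ i • y)‖) := by gcongr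
        _ = κ * ((τ i)⁻¹ * ‖g (p i + τ i • w) - (q i + τ i • y)‖) := by ring
        _ ≤ κ * (‖b - z‖ + ε) := by gcongr
  obtain ⟨w₁, hw₁, -⟩ := key 1 one_pos
  obtain ⟨w', hw', hd⟩ := (isClosed_outerLimit _ _).exists_infDist_eq_dist ⟨w₁, hw₁⟩ w
  refine ⟨w', hw', le_of_forall_pos_le_add fun ε hε => ?_⟩
  obtain ⟨w₂, hw₂, hb⟩ := key (ε / κ) (by positivity)
  rw [← dist_eq_norm, ← hd]
  refine (Metric.infDist_le_dist_of_mem hw₂).trans ?_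
  rw [dist_comm]
  refine (Metric.mem_closedBall.1 hb).trans_eq ?_
  field_simp

theorem mem_outerLimit_of_tendsto (hτ : ∀ᶠ i in ℱ, 0 < τ i) {w : E} {b : F}
    (hlim : Tendsto (fun s : ι × E => (τ s.1)⁻¹ • (g (p s.1 + τ s.1 • s.2) - q s.1))
      (ℱ ×ˢ 𝓝 w) (𝓝 b))
    (hw : w ∈ outerLimit ℱ (fun i => {y | p i + τ i • y ∈ g ⁻¹' K})) :
    b ∈ outerLimit ℱ (fun i => {y | q i + τ i • y ∈ K}) := by
  refine (tendsto_fst.prodMk hlim).frequently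
    ((Filter.Frequently.and_eventually hw (tendsto_fst.eventually hτ)).mono ?_)
  rintro ⟨i, y⟩ ⟨hy, hi⟩
  simp only [Set.mem_ofPred_eq, Set.mem_preimage] at hy hi ⊢
  rw [smul_inv_smul₀ hi.ne']
  simpa using hy

theorem nonneg_of_mem_outerLimit {f : E → ℝ} {x : E} {V : Set E} (hτ : ∀ᶠ i in ℱ, 0 < τ i)
    (hf : ∀ z ∈ C, z ∈ V → f x ≤ f z) {w : E} {β : ℝ}
    (hV : ∀ᶠ s : ι × E in ℱ ×ˢ 𝓝 w, p s.1 + τ s.1 • s.2 ∈ V)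
    (hlim : Tendsto (fun s : ι × E => (τ s.1)⁻¹ • (f (p s.1 + τ s.1 • s.2) - f x))
      (ℱ ×ˢ 𝓝 w) (𝓝 β))
    (hw : w ∈ outerLimit ℱ (fun i => {y | p i + τ i • y ∈ C})) : 0 ≤ β := by
  by_contra! hβ
  have h1 := (hlim.eventually (gt_mem_nhds hβ)).and (hV.and (tendsto_fst.eventually hτ))
  obtain ⟨⟨i, y⟩, hy, h2, h3, h4⟩ := (Filter.Frequently.and_eventually hw h1).exists
  simp only [Set.mem_ofPred_eq, smul_eq_mul] at hy h2 h3 h4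
  have h5 := hf _ hy h3
  have := mul_nonneg (inv_nonneg.2 h4.le) (sub_nonneg.2 h5)
  linarith

end Transfer

/-! ### Multipliers for linearly constrained problems -/

section Multiplier

variable {E F : Type*} [NormedAddCommGroup E] [InnerProductSpace ℝ E]
  [NormedAddCommGroup F] [InnerProductSpace ℝ F] [ProperSpace E] [ProperSpace F]

/-- Approximate stationarity. The hypothesis `H` says that `ω ↦ P ω + η ‖ω‖²` is nonnegative on a
set with `dist(ω, ·) ≤ κ dist(y + A ω, S)`; minimizing the quadratic penalty function
`P ω + (2 η + 1) ‖ω‖² + J / 2 ‖y + A ω - z‖²` over small `ω` and `z ∈ S` near `y` for a large `J`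
gives the multiplier `J (y + A ω - z)`. -/
theorem exists_approx_multiplier {A : E →L[ℝ] F} {S : Set F} (hS : IsClosed S) {y : F} (hy : y ∈ S)
    {r κ η : ℝ} (hr : 0 < r) (hκ : 0 < κ) (hη : 0 ≤ η) (P : E →L[ℝ] ℝ)
    (H : ∀ ω : E, ‖ω‖ ≤ r → ∀ z ∈ S, ‖z - y‖ ≤ r →
      ∃ ω', ‖ω - ω'‖ ≤ κ * ‖y + A ω - z‖ ∧ 0 ≤ P ω' + η * ‖ω'‖ ^ 2) {ε : ℝ} (hε : 0 < ε) :
    ∃ z l, l ∈ frechetNormalCone S z ∧ ‖z - y‖ < ε ∧ ‖l‖ ≤ 4 * κ * ‖P‖ ∧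
      ‖P + (innerSL ℝ l).comp A‖ ≤ ε := by
  set M : ℝ := 4 * κ * ‖P‖ with hM
  have hM0 : 0 ≤ M := by positivity
  obtain ⟨σ, hσ, hσ1, hσ2, hσ3⟩ : ∃ σ > 0, σ ≤ r ∧ σ * (1 + ‖A‖) ≤ min r ε ∧
      2 * (2 * η + 1) * σ ≤ ε := by
    have hm : 0 < min r ε := lt_min hr hε
    refine ⟨min r (min (min r ε / (1 + ‖A‖)) (ε / (2 * (2 * η + 1)))), by positivity,
      min_le_left _ _, ?_, ?_⟩
    · rw [← le_div_iff₀ (by positivity)]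
      exact (min_le_right _ _).trans (min_le_left _ _)
    · rw [mul_comm, ← le_div_iff₀ (by positivity)]
      exact (min_le_right _ _).trans (min_le_right _ _)
  obtain ⟨J, hJ, hJη, hJ1, hJ2⟩ : ∃ J : ℝ, 0 < J ∧ 8 * η * κ ^ 2 ≤ J ∧ M / J < σ ∧
      M / 4 * (M / J) < σ ^ 2 := by
    have h1 : Tendsto (fun J : ℝ => M / J) atTop (𝓝 0) := tendsto_const_nhds.div_atTop tendsto_id
    have h2 : Tendsto (fun J : ℝ => M / 4 * (M / J)) atTop (𝓝 0) := by
      simpa using h1.const_mul (M / 4)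
    exact ((eventually_gt_atTop 0).and ((eventually_ge_atTop _).and
      ((h1.eventually (gt_mem_nhds hσ)).and
        (h2.eventually (gt_mem_nhds (by positivity)))))).exists
  set Φ : E × F → ℝ := fun s =>
    P s.1 + (2 * η + 1) * ‖s.1‖ ^ 2 + J / 2 * ‖y + A s.1 - s.2‖ ^ 2 with hΦ
  have hΦc : Continuous Φ := by fun_prop
  have hQ : IsCompact (Metric.closedBall (0 : E) r ×ˢ (S ∩ Metric.closedBall y r)) :=
    (isCompact_closedBall _ _).prod ((isCompact_closedBall _ _).inter_left hS)
  have h0Q : ((0 : E), y) ∈ Metric.closedBall (0 : E) r ×ˢ (S ∩ Metric.closedBall y r) := by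
    simp [hy, hr.le]
  obtain ⟨⟨ω, z⟩, ⟨hω, hzS, hz⟩, hmin⟩ := hQ.exists_isMinOn ⟨_, h0Q⟩ hΦc.continuousOn
  have hωr : ‖ω‖ ≤ r := by simpa using hω
  have hzr : ‖z - y‖ ≤ r := by rwa [← dist_eq_norm]
  have hle : Φ (ω, z) ≤ 0 := by
    have : Φ (0, y) = 0 := by simp [hΦ]
    exact this ▸ hmin h0Q
  obtain ⟨ω', hω', hPω'⟩ := H ω hωr z hzS hzr
  set s := ‖y + A ω - z‖ with hs
  have hs0 : 0 ≤ s := norm_nonneg _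
  have hbase : ‖ω‖ ^ 2 + J / 4 * s ^ 2 ≤ ‖P‖ * κ * s := by
    have h1 : P ω' - P ω ≤ ‖P‖ * (κ * s) := by
      rw [← map_sub]
      refine (Real.le_norm_self _).trans ((P.le_opNorm _).trans ?_)
      rw [norm_sub_rev]
      gcongr
    have h2 : ‖ω'‖ ≤ ‖ω‖ + κ * s := by
      have := norm_sub_norm_le ω' ω
      rw [norm_sub_rev] at this
      linarith
    have h3 : ‖ω'‖ ^ 2 ≤ 2 * ‖ω‖ ^ 2 + 2 * κ ^ 2 * s ^ 2 := by
      have := pow_le_pow_left₀ (norm_nonneg _) h2 2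
      nlinarith [sq_nonneg (‖ω‖ - κ * s)]
    have h4 := mul_le_mul_of_nonneg_left h3 hη
    have h5 := mul_le_mul_of_nonneg_right hJη (sq_nonneg s)
    have h6 : P ω + (2 * η + 1) * ‖ω‖ ^ 2 + J / 2 * s ^ 2 ≤ 0 := hle
    nlinarith
  have hJs : J * s ≤ M := by
    rcases hs0.eq_or_lt with h | h
    · rw [← h]; simpa using hM0
    · have : J / 4 * s ^ 2 ≤ ‖P‖ * κ * s := by nlinarith [sq_nonneg ‖ω‖]
      have : J / 4 * s ≤ ‖P‖ * κ := le_of_mul_le_mul_right (by linarith) h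
      rw [hM]; linarith
  have hsσ : s < σ := lt_of_le_of_lt (by rw [le_div_iff₀ hJ]; linarith) hJ1
  have hωσ : ‖ω‖ < σ := by
    refine lt_of_pow_lt_pow_left₀ 2 hσ.le (lt_of_le_of_lt ?_ hJ2)
    have h1 : ‖ω‖ ^ 2 ≤ M / 4 * s := by
      have : 0 ≤ J / 4 * s ^ 2 := by positivity
      have h2 : M / 4 * s = ‖P‖ * κ * s := by rw [hM]; ring
      linarith
    refine h1.trans ?_
    gcongr
    rw [le_div_iff₀ hJ]; linarith
  have hzσ : ‖z - y‖ < min r ε := by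
    have h1 : z - y = A ω - (y + A ω - z) := by abel
    have h2 : ‖z - y‖ ≤ ‖A‖ * ‖ω‖ + s := by
      rw [h1]
      exact (norm_sub_le _ _).trans (add_le_add_left (A.le_opNorm ω) _)
    have h3 : ‖A‖ * ‖ω‖ ≤ ‖A‖ * σ := by gcongr
    nlinarith
  refine ⟨z, J • (y + A ω - z), ?_, hzσ.trans_le (min_le_right _ _), ?_, ?_⟩
  · refine mem_frechetNormalCone_of_proximal hzS (c := J / 2) ?_
    have hb : Metric.ball y r ∈ 𝓝 z := Metric.isOpen_ball.mem_nhds (by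
      rw [Metric.mem_ball, dist_eq_norm]; exact hzσ.trans_le (min_le_left _ _))
    filter_upwards [self_mem_nhdsWithin, mem_nhdsWithin_of_mem_nhds hb] with z' hz'S hz'b
    have h1 : Φ (ω, z) ≤ Φ (ω, z') := hmin ⟨hω, hz'S, Metric.ball_subset_closedBall hz'b⟩
    simp only [hΦ] at h1
    have h2 : y + A ω - z' = (y + A ω - z) - (z' - z) := by abel
    rw [h2, norm_sub_sq_real (y + A ω - z) (z' - z)] at h1
    rw [inner_smul_left]
    simp only [conj_trivial]
    nlinarith
  · rwa [norm_smul, Real.norm_of_nonneg hJ.le]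
  · set v : F := y + A ω - z with hv
    have hder : HasFDerivAt (fun ω => Φ (ω, z))
        (P + (2 * η + 1) • (2 • innerSL ℝ ω) + (J / 2) • (2 • (innerSL ℝ v).comp A)) ω := by
      have h1 : HasFDerivAt (fun ω : E => ‖ω‖ ^ 2) (2 • innerSL ℝ ω) ω :=
        (hasStrictFDerivAt_norm_sq ω).hasFDerivAt
      have h2 : HasFDerivAt (fun ω : E => y + A ω - z) A ω :=
        (A.hasFDerivAt.const_add y).sub_const z
      exact (P.hasFDerivAt.add (h1.const_mul _)).add (h2.norm_sq.const_mul _)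
    have hloc : IsLocalMin (fun ω => Φ (ω, z)) ω := by
      have hb : Metric.ball (0 : E) r ∈ 𝓝 ω := Metric.isOpen_ball.mem_nhds (by
        simpa using hωσ.trans_le hσ1)
      filter_upwards [hb] with ω₁ hω₁
      exact hmin ⟨Metric.ball_subset_closedBall hω₁, hzS, hz⟩
    have hzero := hloc.hasFDerivAt_eq_zero hder
    have heq : P + (innerSL ℝ (J • v)).comp A = -((2 * (2 * η + 1)) • innerSL ℝ ω) := by
      rw [← sub_eq_zero, ← hzero]
      ext k
      simp
      ring
    rw [heq, norm_neg, norm_smul, innerSL_apply_norm, Real.norm_of_nonneg (by positivity)]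
    refine le_trans ?_ hσ3
    gcongr

/-- Existence of a limiting-normal multiplier, with a norm bound, at a point where the linear
functional `P` is a (negative) proximal normal to a set satisfying a linear error bound. -/
theorem exists_multiplier {A : E →L[ℝ] F} {S : Set F} (hS : IsClosed S) {y : F} (hy : y ∈ S)
    {r κ η : ℝ} (hr : 0 < r) (hκ : 0 < κ) (hη : 0 ≤ η) (P : E →L[ℝ] ℝ)
    (H : ∀ ω : E, ‖ω‖ ≤ r → ∀ z ∈ S, ‖z - y‖ ≤ r →
      ∃ ω', ‖ω - ω'‖ ≤ κ * ‖y + A ω - z‖ ∧ 0 ≤ P ω' + η * ‖ω'‖ ^ 2) :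
    ∃ l ∈ limitingNormalCone S y, ‖l‖ ≤ 4 * κ * ‖P‖ ∧ P + (innerSL ℝ l).comp A = 0 := by
  have hpos : ∀ k : ℕ, (0 : ℝ) < 1 / ((k : ℝ) + 1) := fun k => Nat.one_div_pos_of_nat
  choose z l hl hz hln hP using fun k : ℕ =>
    exists_approx_multiplier hS hy hr hκ hη P H (hpos k)
  have h0 : Tendsto (fun k : ℕ => 1 / ((k : ℝ) + 1)) atTop (𝓝 0) :=
    tendsto_one_div_add_atTop_nhds_zero_nat
  obtain ⟨l₀, -, φ, hφ, hlim⟩ := tendsto_subseq_of_bounded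
    (Metric.isBounded_closedBall (x := (0 : F)) (r := 4 * κ * ‖P‖))
    (fun k => by simpa using hln k)
  refine ⟨l₀, ⟨hy, z ∘ φ, l ∘ φ, ?_, hlim, fun k => hl _⟩, ?_, ?_⟩
  · refine (tendsto_iff_norm_sub_tendsto_zero.2 ?_).comp hφ.tendsto_atTop
    exact squeeze_zero (fun _ => norm_nonneg _) (fun k => (hz k).le) h0
  · exact le_of_tendsto hlim.norm (.of_forall fun k => hln _)
  · have h1 : Tendsto (fun k => P + (innerSL ℝ (l (φ k))).comp A) atTop
        (𝓝 (P + (innerSL ℝ l₀).comp A)) := by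
      have : Continuous fun v : F => P + (innerSL ℝ v).comp A := by fun_prop
      exact (this.tendsto l₀).comp hlim
    have h2 : Tendsto (fun k => P + (innerSL ℝ (l (φ k))).comp A) atTop (𝓝 0) :=
      squeeze_zero_norm (fun k => hP _) (h0.comp hφ.tendsto_atTop)
    exact tendsto_nhds_unique h1 h2

end Multiplier

/-! ### Directional neighbourhoods and the constraint qualification -/

section Problem

variable {ι E F : Type*} [NormedAddCommGroup E] [InnerProductSpace ℝ E]
  [NormedAddCommGroup F] [InnerProductSpace ℝ F]

theorem eventually_smul_mem_dirNhd {ρ δ : ℝ} (hρ : 0 < ρ) (hδ : 0 < δ) (d : E) :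
    ∀ᶠ s : ℝ × E in 𝓝[>] 0 ×ˢ 𝓝 d, s.1 • s.2 ∈ dirNhd ρ δ d := by
  have h1 : ∀ᶠ s : ℝ × E in 𝓝[>] 0 ×ˢ 𝓝 d, ‖s.1 • s.2‖ ≤ δ := by
    have ht : Tendsto (fun s : ℝ × E => s.1) (𝓝[>] 0 ×ˢ 𝓝 d) (𝓝 0) :=
      tendsto_fst.mono_right nhdsWithin_le_nhds
    have : Tendsto (fun s : ℝ × E => ‖s.1 • s.2‖) (𝓝[>] 0 ×ˢ 𝓝 d) (𝓝 0) := by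
      simpa using (ht.smul tendsto_snd).norm
    exact this.eventually (ge_mem_nhds hδ)
  have h2 : ∀ᶠ e in 𝓝 d, ‖‖d‖ • e - ‖e‖ • d‖ ≤ ρ * ‖e‖ * ‖d‖ := by
    rcases eq_or_ne d 0 with rfl | hd
    · simp
    · have hd' : 0 < ‖d‖ := norm_pos_iff.2 hd
      have hc1 : Continuous fun e : E => ‖‖d‖ • e - ‖e‖ • d‖ := by fun_prop
      have hc2 : Continuous fun e : E => ρ * ‖e‖ * ‖d‖ := by fun_prop
      refine (hc1.continuousAt.eventually_lt hc2.continuousAt ?_).mono fun _ h => h.le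
      simp only [sub_self, norm_zero]
      positivity
  have hpos : ∀ᶠ s : ℝ × E in 𝓝[>] 0 ×ˢ 𝓝 d, 0 < s.1 :=
    tendsto_fst.eventually self_mem_nhdsWithin
  filter_upwards [h1, tendsto_snd.eventually h2, hpos] with s hs1 hs2 hs3
  refine ⟨hs1, ?_⟩
  have h3 : ‖d‖ • s.1 • s.2 - ‖s.1 • s.2‖ • d = s.1 • (‖d‖ • s.2 - ‖s.2‖ • d) := by
    rw [norm_smul, Real.norm_of_nonneg hs3.le]
    module
  rw [h3, norm_smul, norm_smul, Real.norm_of_nonneg hs3.le]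
  calc s.1 * ‖‖d‖ • s.2 - ‖s.2‖ • d‖ ≤ s.1 * (ρ * ‖s.2‖ * ‖d‖) := by gcongr
    _ = ρ * (s.1 * ‖s.2‖) * ‖d‖ := by ring

/-- The constraint qualification with attained distances: as `x ∈ g ⁻¹' K`, no distance to the
empty set occurs on the left-hand side. -/
theorem DirMSCQ.exists_norm_sub_le [ProperSpace E] {G : Type*} [NormedAddCommGroup G]
    {g : E → G} {K : Set G} {x d : E}
    (h : DirMSCQ g K x d) (hC : IsClosed (g ⁻¹' K)) (hx : x ∈ g ⁻¹' K) :
    ∃ ρ δ κ : ℝ, 0 < ρ ∧ 0 < δ ∧ 0 < κ ∧ ∀ z, z - x ∈ dirNhd ρ δ d → ∀ y ∈ K,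
      ∃ z' ∈ g ⁻¹' K, ‖z - z'‖ ≤ κ * ‖g z - y‖ := by
  obtain ⟨ρ, δ, κ, hρ, hδ, hκ, h⟩ := h
  refine ⟨ρ, δ, κ, hρ, hδ, hκ, fun z hz y hy => ?_⟩
  have hset : {z' | (0 : G) ∈ (fun y => g z' - y) '' K} = g ⁻¹' K := by
    ext z'
    simp [sub_eq_zero]
  have h1 := h z hz
  rw [hset] at h1
  have h2 : Metric.infEDist 0 ((fun y => g z - y) '' K) ≤ ENNReal.ofReal ‖g z - y‖ := by
    refine (Metric.infEDist_le_edist_of_mem (Set.mem_image_of_mem _ hy)).trans_eq ?_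
    rw [edist_dist, dist_zero_left]
  obtain ⟨z', hz', hd⟩ := hC.exists_infDist_eq_dist ⟨x, hx⟩ z
  refine ⟨z', hz', ?_⟩
  rw [← dist_eq_norm, ← hd]
  have h3 : Metric.infEDist z (g ⁻¹' K) ≤ ENNReal.ofReal (κ * ‖g z - y‖) := by
    rw [ENNReal.ofReal_mul hκ.le]
    exact h1.trans (by gcongr)
  exact ENNReal.toReal_le_of_le_ofReal (by positivity) h3

/-! ### The Lagrangian -/

theorem fderiv_lagrangian {f : E → ℝ} {g : E → F} (hf : Differentiable ℝ f)
    (hg : Differentiable ℝ g) (l : F) :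
    fderiv ℝ (fun z => lagrangian f g z l) =
      fun z => fderiv ℝ f z + (innerSL ℝ l).comp (fderiv ℝ g z) := by
  ext1 z
  exact ((hf z).hasFDerivAt.add ((innerSL ℝ l).hasFDerivAt.comp z (hg z).hasFDerivAt)).fderiv

theorem secondDeriv_lagrangian {f : E → ℝ} {g : E → F} (hf : ContDiff ℝ 2 f)
    (hg : ContDiff ℝ 2 g) (x d : E) (l : F) :
    secondDeriv (fun z => lagrangian f g z l) x d d =
      secondDeriv f x d d + inner ℝ l (secondDeriv g x d d) := by
  rw [secondDeriv, fderiv_lagrangian (hf.differentiable (by norm_num))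
    (hg.differentiable (by norm_num))]
  have h1 : HasFDerivAt (fderiv ℝ f) (fderiv ℝ (fderiv ℝ f) x) x :=
    ((hf.fderiv_right (m := 1) (by norm_num)).differentiable (by norm_num) x).hasFDerivAt
  have h2 : HasFDerivAt (fderiv ℝ g) (fderiv ℝ (fderiv ℝ g) x) x :=
    ((hg.fderiv_right (m := 1) (by norm_num)).differentiable (by norm_num) x).hasFDerivAt
  have h3 : HasFDerivAt (fun z => (innerSL ℝ l).comp (fderiv ℝ g z))
      (((innerSL ℝ l).postcomp E).comp (fderiv ℝ (fderiv ℝ g) x)) x :=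
    HasFDerivAt.comp x (g := (innerSL ℝ l).postcomp E)
      (ContinuousLinearMap.hasFDerivAt _) h2
  rw [(h1.fun_add h3).fderiv]
  simp [secondDeriv]

/-! ### The lower generalized support function -/

theorem lowerGenSupport_le_of_tendsto {S A : Set F} {l : F} {lk u : ℕ → F} {a : ℕ → ℝ} {b : ℝ}
    (hl : Tendsto lk atTop (𝓝 l)) (hA : ∀ k, u k ∈ A)
    (hN : ∀ k, lk k ∈ limitingNormalCone S (u k)) (hle : ∀ k, inner ℝ (lk k) (u k) ≤ a k)
    (ha : Tendsto a atTop (𝓝 b)) : lowerGenSupport S A l ≤ b := by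
  unfold lowerGenSupport
  split_ifs with hS
  · exact bot_le
  · have h1 : Tendsto (fun k => (a k : EReal)) atTop (𝓝 b) :=
      (continuous_coe_real_ereal.tendsto b).comp ha
    rw [← h1.liminf_eq]
    refine (liminf_le_liminf_of_le hl).trans ?_
    change liminf (fun k => ⨅ u ∈ {u : F | lk k ∈ limitingNormalCone S u} ∩ A,
      ((inner ℝ (lk k) u : ℝ) : EReal)) atTop ≤ _
    refine liminf_le_liminf (.of_forall fun k => ?_)
    exact (iInf₂_le (u k) ⟨hN k, hA k⟩).trans (EReal.coe_le_coe_iff.2 (hle k))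

/-! ### Multipliers from linearizations along a family of scales -/

section Scales

variable [ProperSpace E] [ProperSpace F]

/-- Multipliers for the linearized problems: if the rescaled constraint map converges to
`w ↦ A w + b` and the unscaled constraint is subregular, then a point `w₀` of the outer limit of
the rescaled feasible sets at which `-P` is a proximal normal has a multiplier that is normal to the
outer limit of the rescalings of `K`, with a norm bound independent of `w₀`. -/
theorem exists_multiplier_outerLimit {ℱ : Filter ι} {p : ι → E} {q : ι → F} {τ : ι → ℝ}
    {g : E → F} {K : Set F} (hτ : ∀ᶠ i in ℱ, 0 < τ i)
    {κ : ℝ} (hκ : 0 < κ) {V : Set E}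
    (hsub : ∀ z ∈ V, ∀ y ∈ K, ∃ z' ∈ g ⁻¹' K, ‖z - z'‖ ≤ κ * ‖g z - y‖)
    {A : E →L[ℝ] F} {b : F}
    (hlim : ∀ w, Tendsto (fun s : ι × E => (τ s.1)⁻¹ • (g (p s.1 + τ s.1 • s.2) - q s.1))
      (ℱ ×ˢ 𝓝 w) (𝓝 (A w + b)))
    {w₀ : E} {W : Set E} (hW : W ∈ 𝓝 w₀)
    (hWV : ∀ w ∈ W, ∀ᶠ i in ℱ, p i + τ i • w ∈ V)
    (hw₀ : w₀ ∈ outerLimit ℱ (fun i => {y | p i + τ i • y ∈ g ⁻¹' K}))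
    (P : E →L[ℝ] ℝ) {η : ℝ} (hη : 0 ≤ η)
    (hopt : ∀ w ∈ outerLimit ℱ (fun i => {y | p i + τ i • y ∈ g ⁻¹' K}), w ∈ W →
      0 ≤ P (w - w₀) + η * ‖w - w₀‖ ^ 2) :
    ∃ l ∈ limitingNormalCone (outerLimit ℱ (fun i => {y | q i + τ i • y ∈ K})) (A w₀ + b),
      ‖l‖ ≤ 4 * κ * ‖P‖ ∧ P + (innerSL ℝ l).comp A = 0 := by
  obtain ⟨ρ, hρ, hρW⟩ := Metric.nhds_basis_closedBall.mem_iff.1 hW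
  set r := ρ / (1 + κ * (‖A‖ + 1)) with hr
  have hr0 : 0 < r := by positivity
  have hrρ : r + κ * (‖A‖ * r + r) = ρ := by
    rw [hr]; field_simp
  refine exists_multiplier (isClosed_outerLimit _ _) (mem_outerLimit_of_tendsto hτ (hlim w₀) hw₀)
    hr0 hκ hη P fun ω hω z hz hzr => ?_
  have hωW : w₀ + ω ∈ W := hρW (by
    have : 0 ≤ κ * (‖A‖ * r + r) := by positivity
    rw [Metric.mem_closedBall, dist_eq_norm, add_sub_cancel_left]
    linarith)
  have hlim' : Tendsto (fun i => (τ i)⁻¹ • (g (p i + τ i • (w₀ + ω)) - q i)) ℱ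
      (𝓝 (A (w₀ + ω) + b)) :=
    (hlim (w₀ + ω)).comp (tendsto_id.prodMk tendsto_const_nhds)
  obtain ⟨w', hw', hle⟩ := exists_mem_outerLimit_norm_sub_le hτ hκ hsub (hWV _ hωW) hlim' hz
  have h1 : A (w₀ + ω) + b - z = A w₀ + b + A ω - z := by rw [map_add]; abel
  rw [h1] at hle
  refine ⟨w' - w₀, ?_, hopt w' hw' (hρW ?_)⟩
  · rwa [show ω - (w' - w₀) = w₀ + ω - w' by abel]
  · rw [Metric.mem_closedBall, dist_eq_norm]
    have h2 : ‖A w₀ + b + A ω - z‖ ≤ ‖A‖ * r + r := by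
      rw [show A w₀ + b + A ω - z = A ω - (z - (A w₀ + b)) by abel]
      refine (norm_sub_le _ _).trans (add_le_add ((A.le_opNorm ω).trans ?_) hzr)
      gcongr
    calc ‖w' - w₀‖ = ‖ω - (w₀ + ω - w')‖ := by congr 1; abel
      _ ≤ ‖ω‖ + ‖w₀ + ω - w'‖ := norm_sub_le _ _
      _ ≤ r + κ * (‖A‖ * r + r) := add_le_add hω (hle.trans (by gcongr))
      _ = ρ := hrρ

variable {f : E → ℝ} {g : E → F} {K : Set F} {x d : E}

/-- First-order multipliers: `∇f(x)` is nonnegative on the tangent directions of the feasible set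
close to `d`, so that `exists_multiplier_outerLimit` applies at the tangent direction `d`. -/
theorem dirMultipliers_nonempty (hf : ContDiff ℝ 2 f) (hg : ContDiff ℝ 2 g) (hK : IsClosed K)
    (hd : d ∈ tangentCone (g ⁻¹' K) x) (hmin : IsDirLocalMin f (g ⁻¹' K) x d)
    (hfd : fderiv ℝ f x d = 0) (hMSCQ : DirMSCQ g K x d) :
    (dirMultipliers f g K x d).Nonempty := by
  have hf1 : Differentiable ℝ f := hf.differentiable (by norm_num)
  have hg1 : Differentiable ℝ g := hg.differentiable (by norm_num)
  obtain ⟨hx, ρ₁, δ₁, hρ₁, hδ₁, hfmin⟩ := hmin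
  obtain ⟨ρ₂, δ₂, κ, hρ₂, hδ₂, hκ, hsub⟩ :=
    hMSCQ.exists_norm_sub_le (hK.preimage hg.continuous) hx
  have hτ : ∀ᶠ t : ℝ in 𝓝[>] 0, 0 < t := self_mem_nhdsWithin
  rw [tangentCone_eq_outerLimit] at hd
  set V : Set E := {z | z - x ∈ dirNhd ρ₁ δ₁ d ∧ z - x ∈ dirNhd ρ₂ δ₂ d} with hV
  set W : Set E := {w | ∀ᶠ s : ℝ × E in 𝓝[>] 0 ×ˢ 𝓝 w, x + s.1 • s.2 ∈ V} with hW
  have hWd : W ∈ 𝓝 d := by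
    have h1 : ∀ᶠ s : ℝ × E in 𝓝[>] 0 ×ˢ 𝓝 d, x + s.1 • s.2 ∈ V := by
      filter_upwards [eventually_smul_mem_dirNhd hρ₁ hδ₁ d,
        eventually_smul_mem_dirNhd hρ₂ hδ₂ d] with s hs1 hs2
      simp only [hV, Set.mem_ofPred_eq, add_sub_cancel_left]
      exact ⟨hs1, hs2⟩
    obtain ⟨pa, ha, pb, hb, h⟩ := eventually_prod_iff.1 h1
    filter_upwards [eventually_eventually_nhds.2 hb] with w hw
    exact eventually_prod_iff.2 ⟨pa, ha, pb, hw, h⟩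
  obtain ⟨l, hl, -, hP⟩ := exists_multiplier_outerLimit (ℱ := 𝓝[>] (0 : ℝ)) (p := fun _ => x)
    (q := fun _ => g x) (τ := id) (V := V) (b := 0) hτ hκ (fun z hz => hsub z hz.2)
    (A := fderiv ℝ g x) (fun w => by
      simpa using tendsto_first_order_quotient (hg1 x) w) hWd
    (fun w hw => (tendsto_id.prodMk tendsto_const_nhds).eventually hw) hd (fderiv ℝ f x) le_rfl
    (fun w hw hwW => by
      rw [map_sub, hfd, sub_zero, zero_mul, add_zero]
      exact nonneg_of_mem_outerLimit (p := fun _ => x) (τ := id) (V := V) (f := f) (x := x) hτ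
        (fun z hzC hz => hfmin z hzC hz.1) hwW (tendsto_first_order_quotient (hf1 x) w) hw)
  rw [add_zero] at hl
  refine ⟨l, ?_, ?_⟩
  · exact mem_dirNormalCone_of_mem_limitingNormalCone (t := id) (φ := Prod.snd) hK hτ tendsto_id
      tendsto_snd (.of_forall fun _ _ => rfl) hl
  · rw [fderiv_lagrangian hf1 hg1]
    exact hP

/-- Facts common to the two kinds of second-order tangent sets, for scales `τ = o(t)` with
`t ^ 2 / (2 τ) → c`. With `𝒞` and `S` the second-order tangent sets of the feasible set and of `K`:
the second-order growth of `f` over `𝒞`, nonemptiness of `𝒞`, and multipliers at proximal normals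
to `𝒞`, which are bounded, normal to `S` and directionally normal to `K`. -/
theorem second_order_facts (hf : ContDiff ℝ 2 f) (hg : ContDiff ℝ 2 g) (hK : IsClosed K)
    (hmin : IsDirLocalMin f (g ⁻¹' K) x d) (hfd : fderiv ℝ f x d = 0) (hMSCQ : DirMSCQ g K x d)
    {ℱ : Filter ι} {t τ : ι → ℝ} {c : ℝ} (ht : Tendsto t ℱ (𝓝[>] 0)) (hτ : ∀ᶠ i in ℱ, 0 < τ i)
    (hτt : Tendsto (fun i => τ i / t i) ℱ (𝓝 0))
    (hc : Tendsto (fun i => t i ^ 2 / (2 * τ i)) ℱ (𝓝 c))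
    {𝒞 : Set E} (h𝒞 : 𝒞 = outerLimit ℱ fun i => {w | x + t i • d + τ i • w ∈ g ⁻¹' K})
    {S : Set F} (hS : S = outerLimit ℱ fun i => {w | g x + t i • fderiv ℝ g x d + τ i • w ∈ K}) :
    (∀ w ∈ 𝒞, 0 ≤ fderiv ℝ f x w + c * secondDeriv f x d d) ∧
    (S.Nonempty → 𝒞.Nonempty) ∧
    ∃ κ > 0, ∀ w₀ ∈ 𝒞, ∀ (P : E →L[ℝ] ℝ) (η : ℝ), 0 ≤ η →
      (∀ w ∈ 𝒞, 0 ≤ P (w - w₀) + η * ‖w - w₀‖ ^ 2) →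
      ∃ l ∈ limitingNormalCone S (fderiv ℝ g x w₀ + c • secondDeriv g x d d),
        l ∈ dirNormalCone K (g x) (fderiv ℝ g x d) ∧ ‖l‖ ≤ κ * ‖P‖ ∧
        P + (innerSL ℝ l).comp (fderiv ℝ g x) = 0 := by
  subst h𝒞 hS
  obtain ⟨hx, ρ₁, δ₁, hρ₁, hδ₁, hfmin⟩ := hmin
  obtain ⟨ρ₂, δ₂, κ, hρ₂, hδ₂, hκ, hsub⟩ :=
    hMSCQ.exists_norm_sub_le (hK.preimage hg.continuous) hx
  have htpos : ∀ᶠ i in ℱ, 0 < t i := (tendsto_nhdsWithin_iff.1 ht).2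
  have hdirE : ∀ e u : E,
      Tendsto (fun s : ι × E => e + (τ s.1 / t s.1) • s.2) (ℱ ×ˢ 𝓝 u) (𝓝 e) := by
    intro e u
    have h1 := (hτt.comp tendsto_fst).smul (tendsto_snd : Tendsto Prod.snd (ℱ ×ˢ 𝓝 u) (𝓝 u))
    simpa using h1.const_add e
  have hdirF : ∀ e u : F,
      Tendsto (fun s : ι × F => e + (τ s.1 / t s.1) • s.2) (ℱ ×ˢ 𝓝 u) (𝓝 e) := by
    intro e u
    have h1 := (hτt.comp tendsto_fst).smul (tendsto_snd : Tendsto Prod.snd (ℱ ×ˢ 𝓝 u) (𝓝 u))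
    simpa using h1.const_add e
  set V : Set E := {z | z - x ∈ dirNhd ρ₁ δ₁ d ∧ z - x ∈ dirNhd ρ₂ δ₂ d} with hV
  have hVlim : ∀ w, ∀ᶠ s : ι × E in ℱ ×ˢ 𝓝 w, x + t s.1 • d + τ s.1 • s.2 ∈ V := by
    intro w
    have h1 : Tendsto (fun s : ι × E => (t s.1, d + (τ s.1 / t s.1) • s.2)) (ℱ ×ˢ 𝓝 w)
        (𝓝[>] 0 ×ˢ 𝓝 d) := (ht.comp tendsto_fst).prodMk (hdirE d w)
    filter_upwards [h1.eventually (eventually_smul_mem_dirNhd hρ₁ hδ₁ d),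
      h1.eventually (eventually_smul_mem_dirNhd hρ₂ hδ₂ d),
      tendsto_fst.eventually htpos] with s hs1 hs2 hs3
    have h2 : x + t s.1 • d + τ s.1 • s.2 - x = t s.1 • (d + (τ s.1 / t s.1) • s.2) := by
      have := hs3.ne'
      match_scalars <;> field_simp
      ring
    simp only [hV, Set.mem_ofPred_eq, h2]
    exact ⟨hs1, hs2⟩
  have hVlim' : ∀ w, ∀ᶠ i in ℱ, x + t i • d + τ i • w ∈ V := fun w =>
    (tendsto_id.prodMk tendsto_const_nhds).eventually (hVlim w)
  have hglim := fun w => tendsto_second_order_quotient hg x d w ht hτ hτt hc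
  refine ⟨fun w hw => ?_, ?_, 4 * κ, by positivity, fun w₀ hw₀ P η hη hopt => ?_⟩
  · have hflim := tendsto_second_order_quotient hf x d w ht hτ hτt hc
    simp only [hfd, smul_zero, add_zero] at hflim
    exact nonneg_of_mem_outerLimit (p := fun i => x + t i • d) (f := f) (x := x) (V := V) hτ
      (fun z hzC hz => hfmin z hzC hz.1) (hVlim w) hflim hw
  · rintro ⟨z, hz⟩
    obtain ⟨w', hw', -⟩ := exists_mem_outerLimit_norm_sub_le (p := fun i => x + t i • d)
      (q := fun i => g x + t i • fderiv ℝ g x d) (w := 0)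
      hτ hκ (V := V) (fun z hz => hsub z hz.2) (hVlim' 0)
      ((hglim 0).comp (tendsto_id.prodMk tendsto_const_nhds)) hz
    exact ⟨w', hw'⟩
  · obtain ⟨l, hl, hln, hP⟩ := exists_multiplier_outerLimit (p := fun i => x + t i • d)
      (q := fun i => g x + t i • fderiv ℝ g x d)
      hτ hκ (V := V) (fun z hz => hsub z hz.2) hglim (W := Set.univ) univ_mem
      (fun w _ => hVlim' w) hw₀ P hη (fun w hw _ => hopt w hw)
    refine ⟨l, hl, ?_, hln, hP⟩
    refine mem_dirNormalCone_of_mem_limitingNormalCone hK hτ ht (hdirF _ _) ?_ hl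
    filter_upwards [htpos] with i hi y
    have := hi.ne'
    match_scalars <;> field_simp

/-- The quadratically perturbed linear problem over a closed set on which the linear functional is
bounded below has a solution, which gives a proximal normal. -/
theorem exists_proximal_perturbation {𝒞 : Set E} (h𝒞 : IsClosed 𝒞) {w₁ : E} (hw₁ : w₁ ∈ 𝒞)
    (P : E →L[ℝ] ℝ) {a : ℝ} (ha : ∀ w ∈ 𝒞, 0 ≤ P w + a) {η : ℝ} (hη : 0 < η) :
    ∃ w₀ ∈ 𝒞, η * ‖w₀‖ ^ 2 ≤ P w₁ + η * ‖w₁‖ ^ 2 + a ∧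
      ∀ w ∈ 𝒞, 0 ≤ (P + (2 * η) • innerSL ℝ w₀) (w - w₀) + η * ‖w - w₀‖ ^ 2 := by
  have hcont : Continuous fun w => P w + η * ‖w‖ ^ 2 := by fun_prop
  have hcoer : ∀ᶠ w in cocompact E ⊓ 𝓟 𝒞, P w₁ + η * ‖w₁‖ ^ 2 ≤ P w + η * ‖w‖ ^ 2 := by
    rw [eventually_inf_principal]
    have h1 : Tendsto (fun w : E => η * ‖w‖ ^ 2) (cocompact E) atTop :=
      ((tendsto_pow_atTop two_ne_zero).comp tendsto_norm_cocompact_atTop).const_mul_atTop hη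
    filter_upwards [h1.eventually_ge_atTop (P w₁ + η * ‖w₁‖ ^ 2 + a)] with w hw hwC
    linarith [ha w hwC]
  obtain ⟨w₀, hw₀, hmin⟩ := hcont.continuousOn.exists_isMinOn' h𝒞 hw₁ hcoer
  refine ⟨w₀, hw₀, ?_, fun w hw => ?_⟩
  · have h1 : P w₀ + η * ‖w₀‖ ^ 2 ≤ P w₁ + η * ‖w₁‖ ^ 2 := hmin hw₁
    linarith [ha w₀ hw₀]
  · have h1 : P w₀ + η * ‖w₀‖ ^ 2 ≤ P w + η * ‖w‖ ^ 2 := hmin hw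
    have h2 : ‖w‖ ^ 2 = ‖w₀‖ ^ 2 + 2 * inner ℝ w₀ (w - w₀) + ‖w - w₀‖ ^ 2 := by
      rw [← norm_add_sq_real, add_sub_cancel]
    rw [h2] at h1
    simp only [add_apply, smul_apply, innerSL_apply_apply, smul_eq_mul]
    rw [map_sub]
    linarith

/-- If the asymptotic tangent cone of `K` is empty, its support function is `-∞` and any first-order
multiplier will do; otherwise `0` minimizes `∇f(x)` over the asymptotic tangent cone of the feasible
set and has a multiplier `l`, which is a normal at `0` and is paired with it to `0`. -/
theorem exists_dirMultiplier_asymp (hf : ContDiff ℝ 2 f) (hg : ContDiff ℝ 2 g) (hK : IsClosed K)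
    (hd : d ∈ tangentCone (g ⁻¹' K) x) (hmin : IsDirLocalMin f (g ⁻¹' K) x d)
    (hfd : fderiv ℝ f x d = 0) (hMSCQ : DirMSCQ g K x d) :
    ∃ l ∈ dirMultipliers f g K x d, ∀ A : Set F, Theta g K x d ⊆ A →
      lowerGenSupport (asympTangentCone K (g x) (fderiv ℝ g x d)) A l ≤ 0 := by
  have hfst : Tendsto Prod.fst asympFilter (𝓝[>] (0 : ℝ)) := tendsto_fst.mono_left inf_le_left
  have hsnd : Tendsto Prod.snd asympFilter (𝓝[>] (0 : ℝ)) := tendsto_snd.mono_left inf_le_left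
  have hdiv : Tendsto (fun p : ℝ × ℝ => p.1 / p.2) asympFilter (𝓝 0) :=
    tendsto_comap.mono_left inf_le_right
  have hpos : ∀ᶠ p in asympFilter, 0 < p.1 ∧ 0 < p.2 :=
    (hfst.eventually self_mem_nhdsWithin).and (hsnd.eventually self_mem_nhdsWithin)
  have hτt : Tendsto (fun p : ℝ × ℝ => (1 / 2 * p.1 * p.2) / p.1) asympFilter (𝓝 0) := by
    have h1 : Tendsto (fun p : ℝ × ℝ => 1 / 2 * p.2) asympFilter (𝓝 0) := by
      simpa only [mul_zero] using (tendsto_nhdsWithin_iff.1 hsnd).1.const_mul (1 / 2 : ℝ)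
    refine h1.congr' ?_
    filter_upwards [hpos] with p hp
    have := hp.1.ne'
    field_simp
  have hc : Tendsto (fun p : ℝ × ℝ => p.1 ^ 2 / (2 * (1 / 2 * p.1 * p.2))) asympFilter (𝓝 0) := by
    refine hdiv.congr' ?_
    filter_upwards [hpos] with p hp
    have h1 := hp.1.ne'
    have h2 := hp.2.ne'
    field_simp
  obtain ⟨hgrow, hne, κ, -, hmult⟩ := second_order_facts hf hg hK hmin hfd hMSCQ hfst
    (hpos.mono fun p hp => by have := hp.1; have := hp.2; positivity) hτt hc
    (asympTangentCone_eq_outerLimit _ _ _) (asympTangentCone_eq_outerLimit _ _ _)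
  rcases (asympTangentCone K (g x) (fderiv ℝ g x d)).eq_empty_or_nonempty with hS | hS
  · obtain ⟨l, hl⟩ := dirMultipliers_nonempty hf hg hK hd hmin hfd hMSCQ
    exact ⟨l, hl, fun A _ => by simp [lowerGenSupport, hS]⟩
  · have h0 : (0 : E) ∈ asympTangentCone (g ⁻¹' K) x d := by
      -- A tangent `w` with scales `t r` gives the tangent `0` with the coarser scales `t √r`.
      obtain ⟨w, t, r, u, ht0, ht, hr0, hr, htr, hu, h⟩ := hne hS
      have hsq : Tendsto (fun k => √(r k)) atTop (𝓝 0) := by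
        simpa [Function.comp_def] using (Real.continuous_sqrt.tendsto 0).comp hr
      refine ⟨t, fun k => √(r k), fun k => √(r k) • u k, ht0, ht,
        fun k => Real.sqrt_pos.2 (hr0 k), hsq, ?_, by simpa using hsq.smul hu, fun k => ?_⟩
      · have h1 : Tendsto (fun k => t k / r k * √(r k)) atTop (𝓝 0) := by
          simpa using htr.mul hsq
        refine h1.congr fun k => ?_
        have h2 := Real.mul_self_sqrt (hr0 k).le
        have h3 := (Real.sqrt_pos.2 (hr0 k)).ne'
        nth_rewrite 1 [← h2]
        field_simp
      · have h2 := Real.mul_self_sqrt (hr0 k).le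
        rw [smul_smul, mul_assoc, h2]
        exact h k
    obtain ⟨l, hl, hld, -, hP⟩ := hmult 0 h0 (fderiv ℝ f x) 0 le_rfl fun w hw => by
      simpa using hgrow w hw
    refine ⟨l, ⟨hld, ?_⟩, fun A hA => ?_⟩
    · rw [fderiv_lagrangian (hf.differentiable (by norm_num)) (hg.differentiable (by norm_num))]
      exact hP
    · rw [map_zero, zero_smul, add_zero] at hl
      exact_mod_cast lowerGenSupport_le_of_tendsto (lk := fun _ => l) (u := fun _ => 0)
        (a := fun _ => 0) (b := 0) tendsto_const_nhds
        (fun _ => hA ⟨0, h0, map_zero _⟩) (fun _ => hl) (fun _ => by simp) tendsto_const_nhds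

/-- The linear problem of minimizing `∇f(x) w` over the second-order tangent set of the feasible set
is bounded below but need not have a solution; the multiplier is a limit of multipliers of the
problems perturbed by `η ‖w‖²`, `η ↓ 0`. -/
theorem exists_dirMultiplier_second (hf : ContDiff ℝ 2 f) (hg : ContDiff ℝ 2 g) (hK : IsClosed K)
    (hmin : IsDirLocalMin f (g ⁻¹' K) x d) (hfd : fderiv ℝ f x d = 0) (hMSCQ : DirMSCQ g K x d)
    (hS : (secondTangentSet K (g x) (fderiv ℝ g x d)).Nonempty) :
    ∃ l ∈ dirMultipliers f g K x d, ∀ B : Set F, Omega g K x d ⊆ B →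
      lowerGenSupport (secondTangentSet K (g x) (fderiv ℝ g x d)) B l ≤
        (secondDeriv (fun z => lagrangian f g z l) x d d : ℝ) := by
  have ht : Tendsto id (𝓝[>] (0 : ℝ)) (𝓝[>] 0) := tendsto_id
  have hpos : ∀ᶠ t : ℝ in 𝓝[>] 0, 0 < t := self_mem_nhdsWithin
  have hτt : Tendsto (fun t : ℝ => (1 / 2 * t ^ 2) / t) (𝓝[>] 0) (𝓝 0) := by
    have h1 : Tendsto (fun t : ℝ => 1 / 2 * t) (𝓝[>] 0) (𝓝 0) := by
      simpa only [mul_zero, id] using (tendsto_nhdsWithin_iff.1 ht).1.const_mul (1 / 2)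
    refine h1.congr' ?_
    filter_upwards [hpos] with t ht
    field_simp
  have hc : Tendsto (fun t : ℝ => t ^ 2 / (2 * (1 / 2 * t ^ 2))) (𝓝[>] 0) (𝓝 1) := by
    refine tendsto_const_nhds.congr' ?_
    filter_upwards [hpos] with t ht
    field_simp
  obtain ⟨hgrow, hne, κ, hκ, hmult⟩ := second_order_facts hf hg hK hmin hfd hMSCQ ht
    (hpos.mono fun t ht => by positivity) hτt hc
    (secondTangentSet_eq_outerLimit _ _ _) (secondTangentSet_eq_outerLimit _ _ _)
  obtain ⟨w₁, hw₁⟩ := hne hS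
  simp only [one_mul, one_smul] at hgrow hmult
  set 𝒞 := secondTangentSet (g ⁻¹' K) x d with h𝒞
  have h𝒞c : IsClosed 𝒞 := by
    rw [h𝒞, secondTangentSet_eq_outerLimit]; exact isClosed_outerLimit _ _
  set a := secondDeriv f x d d with ha
  set η : ℕ → ℝ := fun k => 1 / ((k : ℝ) + 1) with hη
  have hη0 : ∀ k, 0 < η k := fun k => Nat.one_div_pos_of_nat
  have hη1 : ∀ k, η k ≤ 1 := fun k => by
    rw [hη]
    exact div_le_one_of_le₀ (by simp) (by positivity)
  have hηlim : Tendsto η atTop (𝓝 0) := tendsto_one_div_add_atTop_nhds_zero_nat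
  choose w hw hwn hwopt using fun k =>
    exists_proximal_perturbation h𝒞c hw₁ (fderiv ℝ f x) hgrow (hη0 k)
  choose l hlN hlD hln hlP using fun k => hmult (w k) (hw k) _ _ (hη0 k).le (hwopt k)
  set D := fderiv ℝ f x w₁ + ‖w₁‖ ^ 2 + a with hD
  have hwD : ∀ k, η k * ‖w k‖ ^ 2 ≤ D := fun k => by
    have := mul_le_mul_of_nonneg_right (hη1 k) (sq_nonneg ‖w₁‖)
    linarith [hwn k]
  have hsq : ∀ k, ‖η k • w k‖ ^ 2 ≤ η k * D := fun k => by
    rw [norm_smul, Real.norm_of_nonneg (hη0 k).le, mul_pow, sq (η k), mul_assoc]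
    exact mul_le_mul_of_nonneg_left (hwD k) (hη0 k).le
  have hzero : Tendsto (fun k => η k • w k) atTop (𝓝 0) := by
    rw [tendsto_zero_iff_norm_tendsto_zero]
    have h1 : Tendsto (fun k => ‖η k • w k‖ ^ 2) atTop (𝓝 0) :=
      squeeze_zero (fun _ => sq_nonneg _) hsq (by simpa using hηlim.mul_const D)
    have h2 := (Real.continuous_sqrt.tendsto 0).comp h1
    simpa [Function.comp_def] using h2
  have hPlim : Tendsto (fun k => fderiv ℝ f x + (2 * η k) • innerSL ℝ (w k)) atTop
      (𝓝 (fderiv ℝ f x)) := by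
    have h1 : Continuous fun v : E => fderiv ℝ f x + (2 : ℝ) • innerSL ℝ v := by fun_prop
    have h2 := (h1.tendsto 0).comp hzero
    simp only [map_zero, smul_zero, add_zero] at h2
    refine h2.congr fun k => ?_
    simp [smul_smul]
  obtain ⟨R, hR⟩ := hPlim.norm.bddAbove_range
  obtain ⟨l₀, -, φ, hφ, hlim⟩ := tendsto_subseq_of_bounded
    (Metric.isBounded_closedBall (x := (0 : F)) (r := κ * R)) (x := l) (fun k => by
      simpa using (hln k).trans (mul_le_mul_of_nonneg_left (hR ⟨k, rfl⟩) hκ.le))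
  refine ⟨l₀, ⟨?_, ?_⟩, fun B hB => ?_⟩
  · rw [dirNormalCone_eq_outerLimit] at hlD ⊢
    exact (isClosed_outerLimit _ _).mem_of_tendsto hlim (.of_forall fun k => hlD _)
  · rw [fderiv_lagrangian (hf.differentiable (by norm_num)) (hg.differentiable (by norm_num))]
    have h1 : Continuous fun v : F => (innerSL ℝ v).comp (fderiv ℝ g x) := by fun_prop
    have h2 := (hPlim.comp hφ.tendsto_atTop).add ((h1.tendsto l₀).comp hlim)
    refine tendsto_nhds_unique h2 ?_
    refine tendsto_const_nhds.congr fun k => ?_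
    exact (hlP (φ k)).symm
  · rw [secondDeriv_lagrangian hf hg]
    refine lowerGenSupport_le_of_tendsto hlim
      (u := fun k => fderiv ℝ g x (w (φ k)) + secondDeriv g x d d)
      (a := fun k => a + inner ℝ (l (φ k)) (secondDeriv g x d d))
      (fun k => hB ⟨_, hw _, rfl⟩) (fun k => hlN _) (fun k => ?_)
      (tendsto_const_nhds.add (hlim.inner tendsto_const_nhds))
    have h1 := congrArg (fun T : E →L[ℝ] ℝ => T (w (φ k))) (hlP (φ k))
    simp only [add_apply, smul_apply, innerSL_apply_apply, ContinuousLinearMap.comp_apply,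
      smul_eq_mul, zero_apply, real_inner_self_eq_norm_sq] at h1
    have h2 := hgrow _ (hw (φ k))
    have h3 : 0 ≤ η (φ k) * ‖w (φ k)‖ ^ 2 := mul_nonneg (hη0 _).le (sq_nonneg _)
    -- The perturbation enters with a favourable sign, `-2 η ‖w‖² ≤ 0`, however large `w` is.
    rw [Function.comp_apply, inner_add_right]
    linarith

end Scales

end Problem

end DirOpt

theorem theorem4p7 (n m : ℕ)
    (f : EuclideanSpace ℝ (Fin n) → ℝ)
    (g : EuclideanSpace ℝ (Fin n) → EuclideanSpace ℝ (Fin m))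
    (K : Set (EuclideanSpace ℝ (Fin m)))
    (hf : ContDiff ℝ 2 f) (hg : ContDiff ℝ 2 g) (hK : IsClosed K)
    (x d : EuclideanSpace ℝ (Fin n))
    (hd : d ∈ DirOpt.tangentCone (g ⁻¹' K) x)
    (hmin : DirOpt.IsDirLocalMin f (g ⁻¹' K) x d)
    (hfd : fderiv ℝ f x d = 0)
    (hMSCQ : DirOpt.DirMSCQ g K x d) :
    (∃ l ∈ DirOpt.dirMultipliers f g K x d,
      (∀ A : Set (EuclideanSpace ℝ (Fin m)), DirOpt.Theta g K x d ⊆ A →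
        DirOpt.lowerGenSupport
          (DirOpt.asympTangentCone K (g x) (fderiv ℝ g x d)) A l ≤ 0) ∧
      DirOpt.lowerGenSupport
        (DirOpt.asympTangentCone K (g x) (fderiv ℝ g x d)) Set.univ l ≤ 0) ∧
    ((DirOpt.secondTangentSet K (g x) (fderiv ℝ g x d)).Nonempty →
      ∃ l ∈ DirOpt.dirMultipliers f g K x d,
        (∀ B : Set (EuclideanSpace ℝ (Fin m)), DirOpt.Omega g K x d ⊆ B →
          ((DirOpt.secondDeriv (fun z => DirOpt.lagrangian f g z l) x d d : ℝ) : EReal) -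
            DirOpt.lowerGenSupport
              (DirOpt.secondTangentSet K (g x) (fderiv ℝ g x d)) B l ≥ 0) ∧
        ((DirOpt.secondDeriv (fun z => DirOpt.lagrangian f g z l) x d d : ℝ) : EReal) -
          DirOpt.lowerGenSupport
            (DirOpt.secondTangentSet K (g x) (fderiv ℝ g x d)) Set.univ l ≥ 0) := by
  refine ⟨?_, fun hS => ?_⟩
  · obtain ⟨l, hl, h⟩ := DirOpt.exists_dirMultiplier_asymp hf hg hK hd hmin hfd hMSCQ
    exact ⟨l, hl, h, h _ (Set.subset_univ _)⟩
  · obtain ⟨l, hl, h⟩ := DirOpt.exists_dirMultiplier_second hf hg hK hmin hfd hMSCQ hS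
    have h' := fun B hB =>
      (EReal.sub_nonneg (.inl (EReal.coe_ne_top _)) (.inl (EReal.coe_ne_bot _))).2 (h B hB)
    exact ⟨l, hl, h', h' _ (Set.subset_univ _)⟩
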